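/- Let $c,d$ be real constants with $c\neq0$, $d\neq0$, $c+d\neq 0$. Consider a semi-discrete system $$u_{1x}=f(x,n,u,v,u_1,v_1,u_x,v_x),\qquad v_{1x}=g(x,n,u,v,u_1,v_1,u_x,v_x)$$ for real functions $u(n,x),v(n,x)$, $n\in\mathbb N$, $x\in\mathbb R$, where $u_1=u(n+1,x)$, $v_1=v(n+1,x)$. For each $n$ let $f,g$ be smooth on an open set $U_n$ of points $(x,u,v,u_1,v_1,u_x,v_x)$ on which $u_x$, $v$, $v_1$, $uv+d$, $u_1v_1+d$ do not vanish, and such that, for each fixed $(u,v,u_1,v_1)$, the set of $(x,u_x,v_x)$ with $(x,u,v,u_1,v_1,u_x,v_x)\in U_n$ is connected or empty. The system is said to admit a function $J(u,v,u_x,v_x,u_{xx},v_{xx})$ as an $n$-integral if on all local solutions both $J$ and its shift $J(u_1,v_1,u_{1x},v_{1x},u_{1xx},v_{1xx})$ are defined (here, for both functions below: $u_x\ne0$, $uv+d\neq0$, $u_{1x}\neq0$, $u_1v_1+d\neq0$) and are equal. Then the system admits the two $n$-integrals $$I_2=\frac{(d-c)v^2u_x^2}{2(uv+d)^2}-\frac{c\,u_xv_x}{uv+d},\qquad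 J_2=\frac{u_{xx}}{u_x}+\frac{(d-c)vu_x-cuv_x}{c(uv+d)}$$ if and only if it has the form $$u_{1x}=\frac{v(u_1v_1+d)\mathcal D_2}{v_1(uv+d)}\,u_x,\qquad v_{1x}=\frac{(d-c)vv_1(\mathcal D_2^2-1)}{2c(uv+d)\mathcal D_2}\,u_x+\frac{v_1}{v\mathcal D_2}\,v_x,$$ where $\mathcal D_2=\mathcal D_2(n,u,v,u_1,v_1)$ is a smooth nowhere vanishing function that is given implicitly by an equation $H(K_2,L_2)=0$ with $$K_2=\frac{v_1(\mathcal D_2-1)M^{-\frac{2d}{c+d}}}{v\mathcal D_2^{2}}\bigl(-2cdu_1v_1+uv\mathcal D_2M\bigr),\quad L_2=\frac{v\mathcal D_2M^{\frac{2d}{c+d}}}{v_1},\quad M=2cd+\frac{(c+d)(\mathcal D_2-1)u_1v_1}{\mathcal D_2}$$ (powers of $M$ being read as powers of $|M|$). Here "given implicitly" means: for each $n$, near each point $(u,v,u_1,v_1)$ at which $M\neq0$ and $(\mathcal D_2,uv)\neq(1,u_1v_1)$, there is a smooth function $H$ of two variables, defined near the value of $(K_2,L_2)$ at that point, such that $H(K_2,L_2)=0$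 holds near the point and the partial derivative of $H(K_2,L_2)$ with respect to $\mathcal D_2$ is nonzero at the point. At the remaining points, where $(K_2,L_2)$ is singular or degenerate, nothing is required beyond the above; where $M$ vanishes identically, $\mathcal D_2=\frac{(c+d)u_1v_1}{2cd+(c+d)u_1v_1}$. -/

import Mathlib

open scoped ContDiff

noncomputable section

namespace SemiDiscrete

/-- Values `(u, v, u₁, v₁)` of the unknowns at the lattice sites `n` and `n + 1`. -/
abbrev Values : Type := ℝ × ℝ × ℝ × ℝ

/-- Arguments `(x, (u, v, u₁, v₁), (u_x, v_x))` of the right-hand sides at a site `n`. -/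
abbrev Args : Type := ℝ × Values × ℝ × ℝ

/-- The argument of the right-hand sides determined at `x` by the functions `u, v` at site `n`
and `u₁, v₁` at site `n + 1`. -/
def argsAt (u v u₁ v₁ : ℝ → ℝ) (x : ℝ) : Args :=
  (x, (u x, v x, u₁ x, v₁ x), (deriv u x, deriv v x))

/-- `(u, v)` at site `n` and `(u₁, v₁)` at site `n + 1` form, on the open interval `(a, b)`, a
twice continuously differentiable solution of `u₁ₓ = f`, `v₁ₓ = g`, where `f, g` are
defined on `U`. -/
structure IsSolutionOn (U : Set Args) (f g : Args → ℝ) (a b : ℝ) (u v u₁ v₁ : ℝ → ℝ) : Prop where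
  smooth_u : ContDiffOn ℝ 2 u (Set.Ioo a b)
  smooth_v : ContDiffOn ℝ 2 v (Set.Ioo a b)
  smooth_u₁ : ContDiffOn ℝ 2 u₁ (Set.Ioo a b)
  smooth_v₁ : ContDiffOn ℝ 2 v₁ (Set.Ioo a b)
  mem : ∀ x ∈ Set.Ioo a b, argsAt u v u₁ v₁ x ∈ U
  eq_u : ∀ x ∈ Set.Ioo a b, deriv u₁ x = f (argsAt u v u₁ v₁ x)
  eq_v : ∀ x ∈ Set.Ioo a b, deriv v₁ x = g (argsAt u v u₁ v₁ x)

/-- A point `(u, v)`, `(u_x, v_x)`, `(u_xx, v_xx)` of the space of second-order jets. -/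
abbrev Jet₂ : Type := (ℝ × ℝ) × (ℝ × ℝ) × (ℝ × ℝ)

/-- The second-order jet of `(u, v)` at `x`. -/
def jetAt (u v : ℝ → ℝ) (x : ℝ) : Jet₂ :=
  ((u x, v x), (deriv u x, deriv v x), (deriv (deriv u) x, deriv (deriv v) x))

/-- `J(x, n, u, v, u_x, v_x, u_xx, v_xx)`, a function with domain of definition `dom`, is an
`n`-integral of the system `u₁ₓ = f`, `v₁ₓ = g`: along all solutions, `J` and its shift `DJ` are
defined and `DJ = J`. -/
def AdmitsNIntegral (U : ℕ → Set Args) (f g : ℕ → Args → ℝ)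
    (dom : Set Jet₂) (J : ℝ → ℕ → Jet₂ → ℝ) : Prop :=
  ∀ (n : ℕ) (a b : ℝ) (u v u₁ v₁ : ℝ → ℝ), IsSolutionOn (U n) (f n) (g n) a b u v u₁ v₁ →
    ∀ x ∈ Set.Ioo a b, jetAt u v x ∈ dom ∧ jetAt u₁ v₁ x ∈ dom ∧
      J x (n + 1) (jetAt u₁ v₁ x) = J x n (jetAt u v x)

/-- The set of jets at which both integrals below are defined: `u_x ≠ 0` and `u v + d ≠ 0`. -/
def integralDomain (d : ℝ) : Set Jet₂ :=
  {((u, v), (ux, _), _) : Jet₂ | ux ≠ 0 ∧ u * v + d ≠ 0}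

/-- The integral `I₂`. -/
def I₂ (c d : ℝ) : ℝ → ℕ → Jet₂ → ℝ :=
  fun _ _ ((u, v), (ux, vx), _) =>
    (d - c) * v ^ 2 * ux ^ 2 / (2 * (u * v + d) ^ 2) - c * ux * vx / (u * v + d)

/-- The integral `J₂`. -/
def J₂ (c d : ℝ) : ℝ → ℕ → Jet₂ → ℝ :=
  fun _ _ ((u, v), (ux, vx), (uxx, _)) =>
    uxx / ux + ((d - c) * v * ux - c * u * vx) / (c * (u * v + d))

/-- The set of arguments at which all denominators in the problem are nonzero. -/
def nondegenerate (d : ℝ) : Set Args :=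
  {(_, (u, v, u₁, v₁), (ux, _)) : Args |
    ux ≠ 0 ∧ v ≠ 0 ∧ v₁ ≠ 0 ∧ u * v + d ≠ 0 ∧ u₁ * v₁ + d ≠ 0}

/-- The values `(u, v, u₁, v₁)` that occur in `U`. -/
def valuesOf (U : Set Args) : Set Values := (fun p : Args => p.2.1) '' U

/-- Right-hand side of the first equation, `s` being the value of the function `𝒟₂`. -/
def rhsU (d s : ℝ) : Args → ℝ :=
  fun (_, (u, v, u₁, v₁), (ux, _)) => v * (u₁ * v₁ + d) * s / (v₁ * (u * v + d)) * ux

/-- Right-hand side of the second equation, `s` being the value of the function `𝒟₂`. -/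
def rhsV (c d s : ℝ) : Args → ℝ :=
  fun (_, (u, v, _, v₁), (ux, vx)) =>
    (d - c) * v * v₁ * (s ^ 2 - 1) / (2 * c * (u * v + d) * s) * ux + v₁ / (v * s) * vx

/-- The function `M`. -/
def M (c d : ℝ) : Values → ℝ → ℝ :=
  fun (_, _, u₁, v₁) s => 2 * c * d + (c + d) * (s - 1) * u₁ * v₁ / s

/-- The function `K₂`. Powers of `M` are powers of `|M|`, so that negative `M` is allowed. -/
def K₂ (c d : ℝ) : Values → ℝ → ℝ :=
  fun (u, v, u₁, v₁) s =>
    v₁ * (s - 1) * |M c d (u, v, u₁, v₁) s| ^ (-(2 * d / (c + d))) / (v * s ^ 2) *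
      (-2 * c * d * u₁ * v₁ + u * v * s * M c d (u, v, u₁, v₁) s)

/-- The function `L₂`. -/
def L₂ (c d : ℝ) : Values → ℝ → ℝ :=
  fun (u, v, u₁, v₁) s => v * s * |M c d (u, v, u₁, v₁) s| ^ (2 * d / (c + d)) / v₁

/-- The points at which `(K₂, L₂)` is a regular pair of functions. Where `M = 0` a power of `M`
is singular; where `s = 1` and `u v = u₁ v₁` the differential of `K₂` vanishes. -/
def Regular (c d : ℝ) : Values → ℝ → Prop :=
  fun (u, v, u₁, v₁) s =>
    M c d (u, v, u₁, v₁) s ≠ 0 ∧ ¬ (s = 1 ∧ u * v = u₁ * v₁)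

/-- Near `q` the function `D` is given implicitly by an equation `H(K₂, L₂) = 0`: `H` is a smooth
function on an open subset of the plane, `D` satisfies the equation near `q`, and at `q` the
derivative of `H(K₂, L₂)` with respect to the unknown value of `D` does not vanish. -/
def GivenImplicitlyAt (c d : ℝ) (D : Values → ℝ) (q : Values) : Prop :=
  ∃ (V : Set (ℝ × ℝ)) (H : ℝ × ℝ → ℝ), IsOpen V ∧ ContDiffOn ℝ ∞ H V ∧
    (K₂ c d q (D q), L₂ c d q (D q)) ∈ V ∧
    (∀ᶠ r in nhds q, H (K₂ c d r (D r), L₂ c d r (D r)) = 0) ∧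
    deriv (fun s => H (K₂ c d q s, L₂ c d q s)) (D q) ≠ 0

/-- The system `u₁ₓ = f`, `v₁ₓ = g` has the required form, with a function
`𝒟₂ = D n (u, v, u₁, v₁)`. -/
def HasForm (c d : ℝ) (U : ℕ → Set Args) (f g : ℕ → Args → ℝ) : Prop :=
  ∃ D : ℕ → Values → ℝ, ∀ n,
    ContDiffOn ℝ ∞ (D n) (valuesOf (U n)) ∧
    (∀ q ∈ valuesOf (U n), D n q ≠ 0) ∧
    (∀ p ∈ U n, f n p = rhsU d (D n p.2.1) p ∧ g n p = rhsV c d (D n p.2.1) p) ∧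
    (∀ q ∈ valuesOf (U n), Regular c d q (D n q) → GivenImplicitlyAt c d (D n) q)

end SemiDiscrete

end

/-!
The function `𝒟₂` is the factor `s` in `u₁ₓ = v (u₁ v₁ + d) s / (v₁ (u v + d)) u_x`. Since
`u_xx` and `v_xx` can be prescribed at a point (`exists_isSolutionOn`), the invariance of `J₂`
forces `f` to be linear in `u_x` and independent of `v_x`, and the invariance of `I₂` then determines `g`
(`integralConditions_of_admits`). What remains of `J₂` is affine in `u_x, v_x`; its coefficients say
that `s` does not depend on `x`, which together with the connectedness of the fibres makes it a
function `D` of `(u, v, u₁, v₁)`, and that `D` satisfies the two first-order equations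
`Determining`: the graph of `D` is tangent to the lifts to `(u, v, u₁, v₁, s)`-space of two vector fields `fieldX`
and `fieldY`.

The functions `K₂` and `L₂` are invariants of the lifted fields, with independent differentials at
regular points (`eq_zero_of_fderiv_combination`). Restricted to the graph, a four-dimensional space,
they are constant along `fieldX`, `fieldY` and the bracket of these, which are linearly independent
at the points of a dense set. Hence the differentials of the restrictions are proportional
(`fderiv_invariants_comm`), and a one-dimensional constant rank argument
(`exists_eventually_eq_comp`) makes one of them a smooth function of the other; this is the relation `H(K₂, L₂) = 0`.

Conversely, implicit differentiation of `H(K₂, L₂) = 0` returns the determining equations at regular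
points. The function `M` is a relative invariant of the lifted fields, so the equations also hold in
the interior of `{M = 0}`, and by density they hold everywhere (`determining_of_regular`). The
invariance of `I₂` and `J₂` is then a computation along solutions.
-/

noncomputable section

namespace SemiDiscrete

open Filter Topology

/-! ### Functional dependence -/

/-- If the derivative of `G` along `y - x` vanishes on a convex set containing `x` and `y`, then
`G y = G x`. -/
theorem eq_of_fderiv_apply_sub_eq_zero {E : Type*} [NormedAddCommGroup E] [NormedSpace ℝ E]
    {s : Set E} (hs : Convex ℝ s) {G : E → ℝ} (hG : ∀ z ∈ s, DifferentiableAt ℝ G z)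
    {x y : E} (hx : x ∈ s) (hy : y ∈ s) (h0 : ∀ z ∈ s, fderiv ℝ G z (y - x) = 0) :
    G y = G x := by
  have hmem : ∀ t ∈ Set.Icc (0 : ℝ) 1, x + t • (y - x) ∈ s := fun t ht =>
    hs.add_smul_sub_mem hx hy ht
  have hd : ∀ t ∈ Set.Icc (0 : ℝ) 1, HasDerivAt (fun t : ℝ => G (x + t • (y - x))) 0 t := by
    intro t ht
    have h1 : HasDerivAt (fun t : ℝ => x + t • (y - x)) (y - x) t := by
      simpa using ((hasDerivAt_id t).smul_const (y - x)).const_add x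
    have h2 := (hG _ (hmem t ht)).hasFDerivAt.comp_hasDerivAt t h1
    rwa [h0 _ (hmem t ht)] at h2
  have := constant_of_has_deriv_right_zero
    (fun t ht => (hd t ht).continuousAt.continuousWithinAt)
    (fun t ht => (hd t ⟨ht.1, ht.2.le⟩).hasDerivWithinAt) 1 (by simp)
  simpa using this

/-- Two functions with proportional differentials are functionally dependent: near a point where
`dφ ≠ 0`, the function `ψ` is a smooth function of `φ`. The map `Ψ` in the proof is tangent to the
identity and straightens the level sets of `φ` to hyperplanes, and `h` is `ψ` restricted to
a transversal line. The hypotheses ask for smoothness at all nearby points, because `ContDiffAt ℝ ∞`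
at `q` alone gives no neighbourhood on which a function is `C^∞`. -/
theorem exists_eventually_eq_comp {E : Type*} [NormedAddCommGroup E] [NormedSpace ℝ E]
    [CompleteSpace E] {φ ψ : E → ℝ} {q : E}
    (hφ : ∀ᶠ r in 𝓝 q, ContDiffAt ℝ ∞ φ r) (hψ : ∀ᶠ r in 𝓝 q, ContDiffAt ℝ ∞ ψ r)
    (h0 : fderiv ℝ φ q ≠ 0)
    (hdep : ∀ᶠ r in 𝓝 q, ∀ a b,
      fderiv ℝ φ r a * fderiv ℝ ψ r b = fderiv ℝ φ r b * fderiv ℝ ψ r a) :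
    ∃ (V : Set ℝ) (h : ℝ → ℝ), IsOpen V ∧ φ q ∈ V ∧ ContDiffOn ℝ ∞ h V ∧
      ∀ᶠ r in 𝓝 q, ψ r = h (φ r) := by
  set l := fderiv ℝ φ q with hl
  obtain ⟨w, hw⟩ : ∃ w, l w = 1 := by
    obtain ⟨w, hw⟩ : ∃ w, l w ≠ 0 := by
      by_contra! hcon
      exact h0 (ContinuousLinearMap.ext hcon)
    exact ⟨(l w)⁻¹ • w, by simp [hw]⟩
  have hφq : ContDiffAt ℝ ∞ φ q := hφ.self_of_nhds
  let Ψ : E → E := fun r => r + (φ r - φ q - l (r - q)) • w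
  have hΨs : ∀ r, ContDiffAt ℝ ∞ φ r → ContDiffAt ℝ ∞ Ψ r := fun r hr =>
    contDiffAt_id.add (((hr.sub contDiffAt_const).sub
      (l.contDiff.contDiffAt.comp r (contDiffAt_id.sub contDiffAt_const))).smul contDiffAt_const)
  have hΨq : Ψ q = q := by simp [Ψ]
  -- In the coordinates given by `Ψ` the function `φ` is affine.
  have hΨl : ∀ r, φ r = l (Ψ r - q) + φ q := by
    intro r
    simp only [Ψ, map_sub, map_add, map_smul, hw, smul_eq_mul]
    ring
  have hΨd : HasFDerivAt Ψ ((ContinuousLinearEquiv.refl ℝ E : E ≃L[ℝ] E) : E →L[ℝ] E) q := by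
    have h1 : HasFDerivAt φ l q := (hφq.differentiableAt (by simp)).hasFDerivAt
    have h2 : HasFDerivAt (fun r => l (r - q)) l q :=
      l.hasFDerivAt.comp q ((hasFDerivAt_id q).sub_const q)
    have := (hasFDerivAt_id q).add (((h1.sub_const (φ q)).sub h2).smul_const w)
    refine this.congr_fderiv ?_
    ext; simp
  let e := (hΨs q hφq).toOpenPartialHomeomorph Ψ hΨd (by simp)
  have hecoe : ∀ r, e r = Ψ r := fun r => by
    rw [ContDiffAt.toOpenPartialHomeomorph_coe]
  have hqs : q ∈ e.source := (hΨs q hφq).mem_toOpenPartialHomeomorph_source hΨd (by simp)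
  have hqt : q ∈ e.target := by
    have := e.map_source hqs
    rwa [hecoe, hΨq] at this
  have hsq : e.symm q = q := by
    have := e.left_inv hqs
    rwa [hecoe, hΨq] at this
  have hcont : Tendsto e.symm (𝓝 q) (𝓝 q) := by
    have := e.continuousAt_symm hqt
    rwa [ContinuousAt, hsq] at this
  -- Invertibility of the derivative near `q` makes the inverse smooth near `q`, not only at `q`.
  have hinv : ∀ᶠ r in 𝓝 q, fderiv ℝ Ψ r ∈
      Set.range ((↑) : (E ≃L[ℝ] E) → E →L[ℝ] E) := by
    have hc : ContinuousAt (fderiv ℝ Ψ) q :=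
      ((hΨs q hφq).fderiv_right (m := 0) (by simp)).continuousAt
    apply hc
    rw [hΨd.fderiv]
    exact ContinuousLinearEquiv.nhds _
  have hS : ∀ᶠ y in 𝓝 q, y ∈ e.target ∧ ContDiffAt ℝ ∞ φ (e.symm y) ∧
      ContDiffAt ℝ ∞ ψ (e.symm y) ∧ (∀ a b, fderiv ℝ φ (e.symm y) a * fderiv ℝ ψ (e.symm y) b =
        fderiv ℝ φ (e.symm y) b * fderiv ℝ ψ (e.symm y) a) ∧
      fderiv ℝ Ψ (e.symm y) ∈ Set.range ((↑) : (E ≃L[ℝ] E) → E →L[ℝ] E) := by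
    filter_upwards [e.open_target.mem_nhds hqt, hcont.eventually hφ, hcont.eventually hψ,
      hcont.eventually hdep, hcont.eventually hinv] with y h1 h2 h3 h4 h5
    exact ⟨h1, h2, h3, h4, h5⟩
  obtain ⟨R, hR, hball⟩ := Metric.eventually_nhds_iff_ball.1 hS
  have hsym : ∀ y ∈ Metric.ball q R, ContDiffAt ℝ ∞ e.symm y := by
    intro y hy
    obtain ⟨h1, h2, -, -, ⟨f', hf'⟩⟩ := hball y hy
    have hcd := hΨs _ h2
    have hee : (e : E → E) = Ψ := funext hecoe
    refine e.contDiffAt_symm (f₀' := f') h1 ?_ ?_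
    · rw [hee, hf']
      exact (hcd.differentiableAt (by simp)).hasFDerivAt
    · rwa [hee]
  have hGs : ∀ y ∈ Metric.ball q R, ContDiffAt ℝ ∞ (ψ ∘ e.symm) y := fun y hy =>
    (hball y hy).2.2.1.comp y (hsym y hy)
  have hG0 : ∀ y ∈ Metric.ball q R, ∀ a, l a = 0 → fderiv ℝ (ψ ∘ e.symm) y a = 0 := by
    intro y hy a ha
    obtain ⟨h1, h2, h3, h4, -⟩ := hball y hy
    have hd := ((hsym y hy).differentiableAt (by simp)).hasFDerivAt
    have hdψ := ((h3.differentiableAt (by simp)).hasFDerivAt.comp y hd).fderiv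
    have hdφ := (h2.differentiableAt (by simp)).hasFDerivAt.comp y hd
    have hφl : HasFDerivAt (φ ∘ e.symm) l y := by
      have : HasFDerivAt (fun z => l (z - q) + φ q) l y :=
        (l.hasFDerivAt.comp y ((hasFDerivAt_id y).sub_const q)).add_const _
      refine this.congr_of_eventuallyEq ?_
      filter_upwards [e.open_target.mem_nhds h1] with z hz
      rw [Function.comp_apply, hΨl, ← hecoe, e.right_inv hz]
    have hll := hdφ.unique hφl
    have e1 := DFunLike.congr_fun hll w
    have e2 := DFunLike.congr_fun hll a
    rw [ContinuousLinearMap.comp_apply] at e1 e2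
    rw [hdψ, ContinuousLinearMap.comp_apply]
    have := h4 (fderiv ℝ e.symm y w) (fderiv ℝ e.symm y a)
    rw [e1, e2, hw, ha] at this
    simpa using this
  let L : ℝ → E := fun t => q + (t - φ q) • w
  have hL : ContDiff ℝ ∞ L :=
    contDiff_const.add ((contDiff_id.sub contDiff_const).smul contDiff_const)
  have hLq : L (φ q) = q := by simp [L]
  refine ⟨L ⁻¹' Metric.ball q R, ψ ∘ e.symm ∘ L, Metric.isOpen_ball.preimage hL.continuous, ?_,
    fun t ht => ?_, ?_⟩
  · simpa [hLq] using hR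
  · exact ((hGs _ ht).comp t hL.contDiffAt).contDiffWithinAt
  · have hΨc : Tendsto Ψ (𝓝 q) (𝓝 q) := by
      have := (hΨs q hφq).continuousAt
      rwa [ContinuousAt, hΨq] at this
    have hLc : Tendsto (fun r => L (φ r)) (𝓝 q) (𝓝 q) := by
      have := (hL.continuous.continuousAt (x := φ q)).comp hφq.continuousAt
      rwa [ContinuousAt, Function.comp_apply, hLq] at this
    have hbn := Metric.ball_mem_nhds q hR
    filter_upwards [hΨc hbn, hLc hbn, e.open_source.mem_nhds hqs] with r h1 h2 h3
    have := eq_of_fderiv_apply_sub_eq_zero (convex_ball q R)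
      (fun z hz => (hGs z hz).differentiableAt (by simp)) h2 h1 (fun z hz => hG0 z hz _ ?_)
    · rw [Function.comp_apply, ← hecoe, e.left_inv h3] at this
      exact this
    · simp only [L, map_sub, map_add, map_smul, hw, smul_eq_mul]
      have := hΨl r
      rw [map_sub] at this
      linarith

/-! ### The vector fields and their invariants -/

/-- The coefficient of `u_x` in the total `x`-derivative of a function of `(u, v, u₁, v₁)` along
solutions of the system with value `s` of `𝒟₂`: the vector field
`∂_u + A ∂_{u₁} + B ∂_{v₁}`, where `A, B` are the coefficients of `u_x` in `u₁ₓ, v₁ₓ`. -/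
def fieldX (c d : ℝ) : Values → ℝ → Values :=
  fun (u, v, u₁, v₁) s => (1, 0, v * (u₁ * v₁ + d) * s / (v₁ * (u * v + d)),
    (d - c) * v * v₁ * (s ^ 2 - 1) / (2 * c * (u * v + d) * s))

/-- The coefficient of `v_x` in the same total derivative, multiplied by `v s` to clear
denominators: the vector field `v s ∂_v + v₁ ∂_{v₁}`. -/
def fieldY : Values → ℝ → Values := fun (_, v, _, v₁) s => (0, v * s, 0, v₁)

/-- The value that the derivative of `𝒟₂` along `fieldX` must have. -/
def slopeX (c d : ℝ) : Values → ℝ → ℝ :=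
  fun (u, v, _, _) s => v * (1 - s) * ((c + d) * s + c - d) / (2 * c * (u * v + d))

/-- The value that the derivative of `𝒟₂` along `fieldY` must have. -/
def slopeY (s : ℝ) : ℝ := s - s ^ 2

theorem contDiffAt_M (c d : ℝ) {z : Values × ℝ} (hs : z.2 ≠ 0) :
    ContDiffAt ℝ ∞ (fun z : Values × ℝ => M c d z.1 z.2) z := by
  unfold M
  fun_prop (disch := assumption)

theorem contDiffAt_K₂ (c d : ℝ) {z : Values × ℝ} (hv : z.1.2.1 ≠ 0) (hs : z.2 ≠ 0)
    (hM : M c d z.1 z.2 ≠ 0) : ContDiffAt ℝ ∞ (fun z : Values × ℝ => K₂ c d z.1 z.2) z := by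
  have h1 := contDiffAt_M c d hs
  have h2 : ContDiffAt ℝ ∞ (fun z : Values × ℝ => |M c d z.1 z.2| ^ (-(2 * d / (c + d)))) z :=
    (h1.abs hM).rpow_const_of_ne (abs_ne_zero.2 hM)
  have h3 : z.1.2.1 * z.2 ^ 2 ≠ 0 := mul_ne_zero hv (pow_ne_zero 2 hs)
  change ContDiffAt ℝ ∞ (fun z : Values × ℝ => z.1.2.2.2 * (z.2 - 1) *
    |M c d z.1 z.2| ^ (-(2 * d / (c + d))) / (z.1.2.1 * z.2 ^ 2) *
    (-2 * c * d * z.1.2.2.1 * z.1.2.2.2 + z.1.1 * z.1.2.1 * z.2 * M c d z.1 z.2)) z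
  fun_prop (disch := assumption)

theorem contDiffAt_L₂ (c d : ℝ) {z : Values × ℝ} (hv₁ : z.1.2.2.2 ≠ 0) (hs : z.2 ≠ 0)
    (hM : M c d z.1 z.2 ≠ 0) : ContDiffAt ℝ ∞ (fun z : Values × ℝ => L₂ c d z.1 z.2) z := by
  have h1 := contDiffAt_M c d hs
  have h2 : ContDiffAt ℝ ∞ (fun z : Values × ℝ => |M c d z.1 z.2| ^ (2 * d / (c + d))) z :=
    (h1.abs hM).rpow_const_of_ne (abs_ne_zero.2 hM)
  change ContDiffAt ℝ ∞ (fun z : Values × ℝ => z.1.2.1 * z.2 *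
    |M c d z.1 z.2| ^ (2 * d / (c + d)) / z.1.2.2.2) z
  fun_prop (disch := assumption)

/-- The derivative of a power of `|m|`, in terms of the logarithmic derivative `ν` of `m`; both
signs of `m` are covered because `Real.log` is the logarithm of the absolute value. -/
theorem hasDerivAt_abs_rpow {m : ℝ → ℝ} {ν t : ℝ} (p : ℝ) (hm : HasDerivAt m (ν * m t) t)
    (h0 : m t ≠ 0) : HasDerivAt (fun t => |m t| ^ p) (|m t| ^ p * (p * ν)) t := by
  have h1 : HasDerivAt (fun t => Real.exp (p * Real.log (m t)))
      (Real.exp (p * Real.log (m t)) * (p * (ν * m t / m t))) t := ((hm.log h0).const_mul p).exp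
  have h2 : ∀ x, x ≠ 0 → |x| ^ p = Real.exp (p * Real.log x) := fun x hx => by
    rw [Real.rpow_def_of_pos (abs_pos.2 hx), Real.log_abs, mul_comm]
  rw [mul_div_cancel_right₀ _ h0, ← h2 _ h0] at h1
  refine h1.congr_of_eventuallyEq ?_
  filter_upwards [hm.continuousAt.eventually_ne h0] with x hx
  exact h2 _ hx

section curves

variable {c d : ℝ} {u v u₁ v₁ s : ℝ → ℝ} {u' v' u₁' v₁' s' ν t : ℝ}

theorem hasDerivAt_M (hu₁ : HasDerivAt u₁ u₁' t) (hv₁ : HasDerivAt v₁ v₁' t)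
    (hs : HasDerivAt s s' t) (hs0 : s t ≠ 0) :
    HasDerivAt (fun t => M c d (u t, v t, u₁ t, v₁ t) (s t))
      ((c + d) * (s' / s t ^ 2 * u₁ t * v₁ t + (s t - 1) / s t * (u₁' * v₁ t + u₁ t * v₁'))) t := by
  have := (((((hs.sub_const 1).const_mul (c + d)).mul hu₁).mul hv₁).div hs hs0).const_add
    (2 * c * d)
  refine this.congr_deriv ?_
  simp only [Pi.mul_apply]
  field_simp
  ring

theorem hasDerivAt_K₂ (hu : HasDerivAt u u' t) (hv : HasDerivAt v v' t)
    (hu₁ : HasDerivAt u₁ u₁' t) (hv₁ : HasDerivAt v₁ v₁' t) (hs : HasDerivAt s s' t)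
    (hM : HasDerivAt (fun t => M c d (u t, v t, u₁ t, v₁ t) (s t))
      (ν * M c d (u t, v t, u₁ t, v₁ t) (s t)) t)
    (hv0 : v t ≠ 0) (hs0 : s t ≠ 0) (hM0 : M c d (u t, v t, u₁ t, v₁ t) (s t) ≠ 0) :
    HasDerivAt (fun t => K₂ c d (u t, v t, u₁ t, v₁ t) (s t))
      (|M c d (u t, v t, u₁ t, v₁ t) (s t)| ^ (-(2 * d / (c + d))) *
        ((v₁' * (s t - 1) / (v t * s t ^ 2) + v₁ t * s' / (v t * s t ^ 2)
            - v₁ t * (s t - 1) * (2 * d / (c + d) * ν) / (v t * s t ^ 2)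
            - v₁ t * (s t - 1) * v' / (v t ^ 2 * s t ^ 2)
            - 2 * v₁ t * (s t - 1) * s' / (v t * s t ^ 3)) *
          (-2 * c * d * u₁ t * v₁ t + u t * v t * s t * M c d (u t, v t, u₁ t, v₁ t) (s t)) +
        v₁ t * (s t - 1) / (v t * s t ^ 2) * (-2 * c * d * (u₁' * v₁ t + u₁ t * v₁') +
          (u' * v t * s t + u t * v' * s t + u t * v t * s' + u t * v t * s t * ν) *
            M c d (u t, v t, u₁ t, v₁ t) (s t)))) t := by
  have hE := hasDerivAt_abs_rpow (-(2 * d / (c + d))) hM hM0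
  have hden : v t * s t ^ 2 ≠ 0 := mul_ne_zero hv0 (pow_ne_zero 2 hs0)
  have := ((((hv₁.mul (hs.sub_const 1)).mul hE).div (hv.mul (hs.pow 2)) hden).mul
    (((hu₁.const_mul (-2 * c * d)).mul hv₁).add (((hu.mul hv).mul hs).mul hM)))
  refine this.congr_deriv ?_
  simp only [Pi.mul_apply, Pi.add_apply, Pi.div_apply, Pi.pow_apply]
  generalize M c d (u t, v t, u₁ t, v₁ t) (s t) = m
  generalize |m| ^ (-(2 * d / (c + d))) = E
  generalize 2 * d / (c + d) = a
  field_simp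
  push_cast
  ring

theorem hasDerivAt_L₂ (hv : HasDerivAt v v' t) (hv₁ : HasDerivAt v₁ v₁' t) (hs : HasDerivAt s s' t)
    (hM : HasDerivAt (fun t => M c d (u t, v t, u₁ t, v₁ t) (s t))
      (ν * M c d (u t, v t, u₁ t, v₁ t) (s t)) t)
    (hv₁0 : v₁ t ≠ 0) (hM0 : M c d (u t, v t, u₁ t, v₁ t) (s t) ≠ 0) :
    HasDerivAt (fun t => L₂ c d (u t, v t, u₁ t, v₁ t) (s t))
      (|M c d (u t, v t, u₁ t, v₁ t) (s t)| ^ (2 * d / (c + d)) *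
        (v' * s t / v₁ t + v t * s' / v₁ t + v t * s t * (2 * d / (c + d) * ν) / v₁ t
          - v t * s t * v₁' / v₁ t ^ 2)) t := by
  have hE := hasDerivAt_abs_rpow (2 * d / (c + d)) hM hM0
  have := (((hv.mul hs).mul hE).div hv₁ hv₁0)
  refine this.congr_deriv ?_
  simp only [Pi.mul_apply]
  field_simp

end curves

section directional

variable {c d u v u₁ v₁ s : ℝ}

theorem hasDerivAt_line (x a : ℝ) : HasDerivAt (fun t : ℝ => x + t * a) a 0 := by
  simpa using ((hasDerivAt_id (0 : ℝ)).mul_const a).const_add x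

theorem hasDerivAt_comp_line {E G : Type*} [NormedAddCommGroup E] [NormedSpace ℝ E]
    [NormedAddCommGroup G] [NormedSpace ℝ G] {F : E → G} {z : E}
    (hF : DifferentiableAt ℝ F z) (w : E) :
    HasDerivAt (fun t : ℝ => F (z + t • w)) (fderiv ℝ F z w) 0 := by
  have h1 : HasDerivAt (fun t : ℝ => z + t • w) w 0 := by
    simpa using ((hasDerivAt_id (0 : ℝ)).smul_const w).const_add z
  have h2 : HasFDerivAt F (fderiv ℝ F z) (z + (0 : ℝ) • w) := by simpa using hF.hasFDerivAt
  exact h2.comp_hasDerivAt 0 h1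

theorem hasDerivAt_M_line (hs : s ≠ 0) (a b a₁ b₁ e : ℝ) :
    HasDerivAt (fun t : ℝ => M c d (u + t * a, v + t * b, u₁ + t * a₁, v₁ + t * b₁) (s + t * e))
      ((c + d) * (e / s ^ 2 * u₁ * v₁ + (s - 1) / s * (a₁ * v₁ + u₁ * b₁))) 0 := by
  have := hasDerivAt_M (c := c) (d := d) (u := fun t => u + t * a) (v := fun t => v + t * b)
    (hasDerivAt_line u₁ a₁) (hasDerivAt_line v₁ b₁)
    (hasDerivAt_line s e) (by simpa using hs)
  simpa using this

/-- The differential of `K₂` on the tangent vector `(a, b, a₁, b₁, e)`, where `ν` is the logarithmic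
derivative of `M` in that direction. -/
theorem fderiv_K₂_apply {a b a₁ b₁ e ν : ℝ} (hv : v ≠ 0) (hs : s ≠ 0)
    (hM : M c d (u, v, u₁, v₁) s ≠ 0)
    (hν : (c + d) * (e / s ^ 2 * u₁ * v₁ + (s - 1) / s * (a₁ * v₁ + u₁ * b₁)) =
      ν * M c d (u, v, u₁, v₁) s) :
    fderiv ℝ (fun z : Values × ℝ => K₂ c d z.1 z.2) ((u, v, u₁, v₁), s) ((a, b, a₁, b₁), e) =
      |M c d (u, v, u₁, v₁) s| ^ (-(2 * d / (c + d))) *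
        ((b₁ * (s - 1) / (v * s ^ 2) + v₁ * e / (v * s ^ 2)
            - v₁ * (s - 1) * (2 * d / (c + d) * ν) / (v * s ^ 2)
            - v₁ * (s - 1) * b / (v ^ 2 * s ^ 2)
            - 2 * v₁ * (s - 1) * e / (v * s ^ 3)) *
          (-2 * c * d * u₁ * v₁ + u * v * s * M c d (u, v, u₁, v₁) s) +
        v₁ * (s - 1) / (v * s ^ 2) * (-2 * c * d * (a₁ * v₁ + u₁ * b₁) +
          (a * v * s + u * b * s + u * v * e + u * v * s * ν) * M c d (u, v, u₁, v₁) s)) := by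
  have h1 := hasDerivAt_comp_line (F := fun z : Values × ℝ => K₂ c d z.1 z.2)
    ((contDiffAt_K₂ c d (z := ((u, v, u₁, v₁), s)) hv hs hM).differentiableAt (by simp))
    ((a, b, a₁, b₁), e)
  have h2 := hasDerivAt_M_line (c := c) (d := d) (u := u) (v := v) (u₁ := u₁) (v₁ := v₁) hs
    a b a₁ b₁ e
  rw [hν] at h2
  have h3 := hasDerivAt_K₂ (c := c) (d := d) (ν := ν) (hasDerivAt_line u a) (hasDerivAt_line v b)
    (hasDerivAt_line u₁ a₁) (hasDerivAt_line v₁ b₁) (hasDerivAt_line s e) (by simpa using h2)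
    (by simpa using hv) (by simpa using hs) (by simpa using hM)
  have := h1.unique h3
  simpa only [zero_mul, add_zero] using this

/-- The differential of `L₂` on the tangent vector `(a, b, a₁, b₁, e)`, where `ν` is the logarithmic
derivative of `M` in that direction. -/
theorem fderiv_L₂_apply {a b a₁ b₁ e ν : ℝ} (hv₁ : v₁ ≠ 0) (hs : s ≠ 0)
    (hM : M c d (u, v, u₁, v₁) s ≠ 0)
    (hν : (c + d) * (e / s ^ 2 * u₁ * v₁ + (s - 1) / s * (a₁ * v₁ + u₁ * b₁)) =
      ν * M c d (u, v, u₁, v₁) s) :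
    fderiv ℝ (fun z : Values × ℝ => L₂ c d z.1 z.2) ((u, v, u₁, v₁), s) ((a, b, a₁, b₁), e) =
      |M c d (u, v, u₁, v₁) s| ^ (2 * d / (c + d)) *
        (b * s / v₁ + v * e / v₁ + v * s * (2 * d / (c + d) * ν) / v₁ - v * s * b₁ / v₁ ^ 2) := by
  have h1 := hasDerivAt_comp_line (F := fun z : Values × ℝ => L₂ c d z.1 z.2)
    ((contDiffAt_L₂ c d (z := ((u, v, u₁, v₁), s)) hv₁ hs hM).differentiableAt (by simp))
    ((a, b, a₁, b₁), e)
  have h2 := hasDerivAt_M_line (c := c) (d := d) (u := u) (v := v) (u₁ := u₁) (v₁ := v₁) hs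
    a b a₁ b₁ e
  rw [hν] at h2
  have h3 := hasDerivAt_L₂ (c := c) (d := d) (ν := ν) (u := fun t => u + t * a)
    (u₁ := fun t => u₁ + t * a₁) (hasDerivAt_line v b)
    (hasDerivAt_line v₁ b₁) (hasDerivAt_line s e) (by simpa using h2)
    (by simpa using hv₁) (by simpa using hM)
  have := h1.unique h3
  simpa only [zero_mul, add_zero] using this

/-- `M` is a relative invariant of the lift of `fieldX` to `(u, v, u₁, v₁, s)`-space. -/
theorem M_fieldX (hc : c ≠ 0) (hv₁ : v₁ ≠ 0) (hs : s ≠ 0) :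
    (c + d) * (slopeX c d (u, v, u₁, v₁) s / s ^ 2 * u₁ * v₁ + (s - 1) / s *
      (v * (u₁ * v₁ + d) * s / (v₁ * (u * v + d)) * v₁ +
        u₁ * ((d - c) * v * v₁ * (s ^ 2 - 1) / (2 * c * (u * v + d) * s)))) =
      (v * (s - 1) * (c + d) / (2 * c * (u * v + d))) * M c d (u, v, u₁, v₁) s := by
  simp only [slopeX, M]
  field_simp
  ring

/-- `M` is invariant under the lift of `fieldY` to `(u, v, u₁, v₁, s)`-space. -/
theorem M_fieldY (hs : s ≠ 0) :
    (c + d) * (slopeY s / s ^ 2 * u₁ * v₁ + (s - 1) / s * (0 * v₁ + u₁ * v₁)) =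
      0 * M c d (u, v, u₁, v₁) s := by
  simp only [slopeY]
  field_simp
  ring

theorem K₂_fieldX (hc : c ≠ 0) (hcd : c + d ≠ 0) (hv : v ≠ 0) (hv₁ : v₁ ≠ 0) (hs : s ≠ 0)
    (hQ : u * v + d ≠ 0) (hM : M c d (u, v, u₁, v₁) s ≠ 0) :
    fderiv ℝ (fun z : Values × ℝ => K₂ c d z.1 z.2) ((u, v, u₁, v₁), s)
      (fieldX c d (u, v, u₁, v₁) s, slopeX c d (u, v, u₁, v₁) s) = 0 := by
  rw [fieldX, fderiv_K₂_apply hv hs hM (M_fieldX hc hv₁ hs)]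
  refine mul_eq_zero_of_right _ ?_
  simp only [slopeX, M]
  have hQ' : v * u + d ≠ 0 := by rwa [mul_comm]
  field_simp
  ring

theorem K₂_fieldY (hv : v ≠ 0) (hs : s ≠ 0) (hM : M c d (u, v, u₁, v₁) s ≠ 0) :
    fderiv ℝ (fun z : Values × ℝ => K₂ c d z.1 z.2) ((u, v, u₁, v₁), s)
      (fieldY (u, v, u₁, v₁) s, slopeY s) = 0 := by
  rw [fieldY, fderiv_K₂_apply hv hs hM (M_fieldY hs)]
  refine mul_eq_zero_of_right _ ?_
  simp only [slopeY, M]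
  field_simp
  ring

theorem L₂_fieldX (hc : c ≠ 0) (hcd : c + d ≠ 0) (hv₁ : v₁ ≠ 0) (hs : s ≠ 0)
    (hM : M c d (u, v, u₁, v₁) s ≠ 0) :
    fderiv ℝ (fun z : Values × ℝ => L₂ c d z.1 z.2) ((u, v, u₁, v₁), s)
      (fieldX c d (u, v, u₁, v₁) s, slopeX c d (u, v, u₁, v₁) s) = 0 := by
  rw [fieldX, fderiv_L₂_apply hv₁ hs hM (M_fieldX hc hv₁ hs)]
  refine mul_eq_zero_of_right _ ?_
  simp only [slopeX]
  field_simp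
  ring

theorem L₂_fieldY (hv₁ : v₁ ≠ 0) (hs : s ≠ 0) (hM : M c d (u, v, u₁, v₁) s ≠ 0) :
    fderiv ℝ (fun z : Values × ℝ => L₂ c d z.1 z.2) ((u, v, u₁, v₁), s)
      (fieldY (u, v, u₁, v₁) s, slopeY s) = 0 := by
  rw [fieldY, fderiv_L₂_apply hv₁ hs hM (M_fieldY hs)]
  refine mul_eq_zero_of_right _ ?_
  simp only [slopeY]
  field_simp
  ring

/-- At regular points the differentials of `K₂` and `L₂` are linearly independent. -/
theorem eq_zero_of_fderiv_combination (hc : c ≠ 0) (hd : d ≠ 0)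
    (hv : v ≠ 0) (hv₁ : v₁ ≠ 0) (hs : s ≠ 0)
    (hreg : Regular c d (u, v, u₁, v₁) s) {α β : ℝ}
    (h : ∀ w, α * fderiv ℝ (fun z : Values × ℝ => K₂ c d z.1 z.2) ((u, v, u₁, v₁), s) w +
      β * fderiv ℝ (fun z : Values × ℝ => L₂ c d z.1 z.2) ((u, v, u₁, v₁), s) w = 0) :
    α = 0 ∧ β = 0 := by
  obtain ⟨hM, hne⟩ := hreg
  have hE : ∀ p : ℝ, |M c d (u, v, u₁, v₁) s| ^ p ≠ 0 := fun p =>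
    (Real.rpow_pos_of_pos (abs_pos.2 hM) p).ne'
  have hα : α = 0 := by
    by_cases hs1 : s = 1
    · subst hs1
      have hM1 : M c d (u, v, u₁, v₁) 1 = 2 * c * d := by simp [M]
      have hne' : u * v - u₁ * v₁ ≠ 0 := fun h0 => hne ⟨rfl, by linarith⟩
      -- The direction is `∂_s` corrected by `∂_v` so as to be annihilated by `dL₂`.
      have hν : (c + d) * (1 / 1 ^ 2 * u₁ * v₁ + (1 - 1) / 1 * (0 * v₁ + u₁ * 0)) =
          ((c + d) * u₁ * v₁ / (2 * c * d)) * M c d (u, v, u₁, v₁) 1 := by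
        rw [hM1]; field_simp; ring
      have h1 := h ((0, -(v + v * (2 * d / (c + d) * ((c + d) * u₁ * v₁ / (2 * c * d)))), 0, 0), 1)
      rw [fderiv_K₂_apply hv hs hM hν, fderiv_L₂_apply hv₁ hs hM hν] at h1
      have h2 : α * (|M c d (u, v, u₁, v₁) 1| ^ (-(2 * d / (c + d))) *
          (v₁ / v * (2 * c * d * (u * v - u₁ * v₁)))) = 0 := by
        rw [← h1, hM1]
        generalize |2 * c * d| ^ (-(2 * d / (c + d))) = E
        generalize |2 * c * d| ^ (2 * d / (c + d)) = E'
        generalize 2 * d / (c + d) = A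
        field_simp
        ring
      have h3 : |M c d (u, v, u₁, v₁) 1| ^ (-(2 * d / (c + d))) *
          (v₁ / v * (2 * c * d * (u * v - u₁ * v₁))) ≠ 0 := by
        refine mul_ne_zero (hE _) ?_
        positivity
      exact (mul_eq_zero.1 h2).resolve_right h3
    · have h1 := h ((1, 0, 0, 0), 0)
      rw [fderiv_K₂_apply (ν := 0) hv hs hM (by simp),
        fderiv_L₂_apply (ν := 0) hv₁ hs hM (by simp)] at h1
      have h2 : α * (|M c d (u, v, u₁, v₁) s| ^ (-(2 * d / (c + d))) *
          (v₁ * (s - 1) / s * M c d (u, v, u₁, v₁) s)) = 0 := by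
        rw [← h1]
        field_simp
        ring
      have h3 : |M c d (u, v, u₁, v₁) s| ^ (-(2 * d / (c + d))) *
          (v₁ * (s - 1) / s * M c d (u, v, u₁, v₁) s) ≠ 0 := by
        have := sub_ne_zero.2 hs1
        refine mul_ne_zero (hE _) ?_
        positivity
      exact (mul_eq_zero.1 h2).resolve_right h3
  refine ⟨hα, ?_⟩
  have h1 := h ((0, 1, 0, 0), 0)
  rw [hα, fderiv_L₂_apply (ν := 0) hv₁ hs hM (by simp)] at h1
  have h3 : s / v₁ ≠ 0 := div_ne_zero hs hv₁
  simpa [hE, hs, hv₁] using h1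

end directional

/-! ### The determining equations and their implicit solutions -/

section graph

/-- The two first-order equations for `𝒟₂ = D` at `q` which express that the total `x`-derivative of
`D` along solutions is the one required by the integral `J₂`. They say that the graph of `D` is
tangent to the lifts `(fieldX, slopeX)` and `(fieldY, slopeY)`. -/
def Determining (c d : ℝ) (D : Values → ℝ) (q : Values) : Prop :=
  fderiv ℝ D q (fieldX c d q (D q)) = slopeX c d q (D q) ∧
    fderiv ℝ D q (fieldY q (D q)) = slopeY (D q)

/-- The values `(u, v, u₁, v₁)` at which `v`, `v₁`, `u v + d`, `u₁ v₁ + d` do not vanish. -/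
def nondegenerateValues (d : ℝ) : Set Values :=
  {(u, v, u₁, v₁) : Values | v ≠ 0 ∧ v₁ ≠ 0 ∧ u * v + d ≠ 0 ∧ u₁ * v₁ + d ≠ 0}

variable {c d : ℝ} {D : Values → ℝ} {q : Values}

theorem isOpen_nondegenerateValues (d : ℝ) : IsOpen (nondegenerateValues d) := by
  have : nondegenerateValues d = {q : Values | q.2.1 ≠ 0} ∩ {q | q.2.2.2 ≠ 0} ∩
      {q | q.1 * q.2.1 + d ≠ 0} ∩ {q | q.2.2.1 * q.2.2.2 + d ≠ 0} := by
    ext ⟨u, v, u₁, v₁⟩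
    simp [nondegenerateValues, and_assoc]
  rw [this]
  refine (((isOpen_ne_fun ?_ ?_).inter (isOpen_ne_fun ?_ ?_)).inter (isOpen_ne_fun ?_ ?_)).inter
    (isOpen_ne_fun ?_ ?_) <;> fun_prop

theorem hasFDerivAt_comp_graph {F : Values × ℝ → ℝ} (hF : DifferentiableAt ℝ F (q, D q))
    (hD : DifferentiableAt ℝ D q) :
    HasFDerivAt (fun r => F (r, D r))
      ((fderiv ℝ F (q, D q)).comp ((ContinuousLinearMap.id ℝ Values).prod (fderiv ℝ D q))) q :=
  HasFDerivAt.comp q (f := fun r => (r, D r)) hF.hasFDerivAt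
    ((hasFDerivAt_id q).prodMk hD.hasFDerivAt)

theorem fderiv_comp_graph_apply {F : Values × ℝ → ℝ} (hF : DifferentiableAt ℝ F (q, D q))
    (hD : DifferentiableAt ℝ D q) (a : Values) :
    fderiv ℝ (fun r => F (r, D r)) q a = fderiv ℝ F (q, D q) (a, fderiv ℝ D q a) := by
  rw [(hasFDerivAt_comp_graph hF hD).fderiv]
  rfl

theorem hasFDerivAt_comp_invariants (hq : q ∈ nondegenerateValues d) (hDq : D q ≠ 0)
    (hM : M c d q (D q) ≠ 0) {H : ℝ × ℝ → ℝ}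
    (hH : DifferentiableAt ℝ H (K₂ c d q (D q), L₂ c d q (D q))) :
    HasFDerivAt (fun z : Values × ℝ => H (K₂ c d z.1 z.2, L₂ c d z.1 z.2))
      ((fderiv ℝ H (K₂ c d q (D q), L₂ c d q (D q))).comp
        ((fderiv ℝ (fun z : Values × ℝ => K₂ c d z.1 z.2) (q, D q)).prod
          (fderiv ℝ (fun z : Values × ℝ => L₂ c d z.1 z.2) (q, D q)))) (q, D q) := by
  have hK := (contDiffAt_K₂ c d (z := (q, D q)) hq.1 hDq hM).differentiableAt (by simp)
  have hL := (contDiffAt_L₂ c d (z := (q, D q)) hq.2.1 hDq hM).differentiableAt (by simp)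
  exact HasFDerivAt.comp (q, D q)
    (f := fun z : Values × ℝ => (K₂ c d z.1 z.2, L₂ c d z.1 z.2)) hH.hasFDerivAt
    (hK.hasFDerivAt.prodMk hL.hasFDerivAt)

theorem deriv_eq_fderiv_snd {F : Values × ℝ → ℝ} (hF : DifferentiableAt ℝ F (q, D q)) :
    deriv (fun s => F (q, s)) (D q) = fderiv ℝ F (q, D q) (0, 1) := by
  have := HasFDerivAt.comp_hasDerivAt (D q) (f := fun s => (q, s)) hF.hasFDerivAt
    ((hasDerivAt_const (D q) q).prodMk (hasDerivAt_id (D q)))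
  exact this.deriv

/-- Implicit differentiation: `K₂` and `L₂` are invariant under the two lifted fields, so these are
tangent to `{H(K₂, L₂) = 0}`, which near `(q, D q)` is the graph of `D`. -/
theorem determining_of_givenImplicitlyAt (hc : c ≠ 0) (hcd : c + d ≠ 0)
    (hq : q ∈ nondegenerateValues d) (hDq : D q ≠ 0) (hM : M c d q (D q) ≠ 0)
    (hD : DifferentiableAt ℝ D q) (himp : GivenImplicitlyAt c d D q) : Determining c d D q := by
  obtain ⟨V, H, hV, hH, hmem, hev, hder⟩ := himp
  have hF := hasFDerivAt_comp_invariants hq hDq hM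
    (((hH.contDiffAt (hV.mem_nhds hmem)).differentiableAt (by simp)))
  set F : Values × ℝ → ℝ := fun z => H (K₂ c d z.1 z.2, L₂ c d z.1 z.2) with hFdef
  have hgraph : ∀ a, fderiv ℝ F (q, D q) (a, fderiv ℝ D q a) = 0 := by
    intro a
    rw [← fderiv_comp_graph_apply hF.differentiableAt hD]
    have h0 : (fun r => F (r, D r)) =ᶠ[𝓝 q] fun _ => 0 := hev
    rw [h0.fderiv_eq]
    simp
  have hs : fderiv ℝ F (q, D q) (0, 1) ≠ 0 := by
    rw [← deriv_eq_fderiv_snd hF.differentiableAt]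
    exact hder
  have key : ∀ (a : Values) (e : ℝ), fderiv ℝ F (q, D q) (a, e) = 0 → fderiv ℝ D q a = e := by
    intro a e hae
    have h1 : (a, fderiv ℝ D q a) - (a, e) =
        (fderiv ℝ D q a - e) • ((0, 1) : Values × ℝ) := by simp
    have h2 := (fderiv ℝ F (q, D q)).map_sub (a, fderiv ℝ D q a) (a, e)
    rw [h1, map_smul, hgraph, hae, sub_zero, smul_eq_mul] at h2
    exact sub_eq_zero.1 ((mul_eq_zero.1 h2).resolve_right hs)
  obtain ⟨u, v, u₁, v₁⟩ := q
  obtain ⟨h1, h2, h3, h4⟩ := hq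
  constructor
  · apply key
    rw [hF.fderiv, ContinuousLinearMap.comp_apply, ContinuousLinearMap.prod_apply,
      K₂_fieldX hc hcd h1 h2 hDq h3 hM, L₂_fieldX hc hcd h2 hDq hM]
    exact map_zero _
  · apply key
    rw [hF.fderiv, ContinuousLinearMap.comp_apply, ContinuousLinearMap.prod_apply,
      K₂_fieldY h1 hDq hM, L₂_fieldY h2 hDq hM]
    exact map_zero _

/-- The exceptional solution `M = 0`: as `M` is a relative invariant of the lifted fields, these are
tangent to the hypersurface `M = 0`. -/
theorem determining_of_M_eq_zero (hc : c ≠ 0) (hd : d ≠ 0) (hcd : c + d ≠ 0)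
    (hq : q ∈ nondegenerateValues d) (hDq : D q ≠ 0)
    (hD : DifferentiableAt ℝ D q) (hM : ∀ᶠ r in 𝓝 q, M c d r (D r) = 0) :
    Determining c d D q := by
  have hM0 := hM.self_of_nhds
  have hzero : ∀ a, fderiv ℝ (fun z : Values × ℝ => M c d z.1 z.2) (q, D q)
      (a, fderiv ℝ D q a) = 0 := by
    intro a
    rw [← fderiv_comp_graph_apply ((contDiffAt_M c d (z := (q, D q)) hDq).differentiableAt
      (by simp)) hD]
    have h0 : (fun r => M c d r (D r)) =ᶠ[𝓝 q] fun _ => 0 := hM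
    rw [h0.fderiv_eq]
    simp
  obtain ⟨u, v, u₁, v₁⟩ := q
  obtain ⟨h1, h2, h3, h4⟩ := hq
  set s := D (u, v, u₁, v₁) with hs
  have hlin : ∀ a b a₁ b₁ e : ℝ, fderiv ℝ (fun z : Values × ℝ => M c d z.1 z.2)
      ((u, v, u₁, v₁), s) ((a, b, a₁, b₁), e) =
      (c + d) * (e / s ^ 2 * u₁ * v₁ + (s - 1) / s * (a₁ * v₁ + u₁ * b₁)) := by
    intro a b a₁ b₁ e
    exact (hasDerivAt_comp_line ((contDiffAt_M c d (z := ((u, v, u₁, v₁), s)) hDq).differentiableAt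
      (by simp)) ((a, b, a₁, b₁), e)).unique (hasDerivAt_M_line hDq a b a₁ b₁ e)
  have hP : u₁ * v₁ ≠ 0 := by
    intro h0
    have : M c d (u, v, u₁, v₁) s = 2 * c * d := by
      simp only [M]
      rw [mul_assoc _ u₁ v₁, h0]
      simp
    rw [hM0] at this
    have h5 : 2 * c * d ≠ 0 := by positivity
    exact h5 this.symm
  have key : ∀ e e' x : ℝ, (c + d) * (e / s ^ 2 * u₁ * v₁ + x) = 0 →
      (c + d) * (e' / s ^ 2 * u₁ * v₁ + x) = 0 → e = e' := by
    intro e e' x he he'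
    have h6 : (c + d) * (u₁ * v₁) / s ^ 2 * (e - e') = 0 := by
      linear_combination he - he'
    have h7 : (c + d) * (u₁ * v₁) / s ^ 2 ≠ 0 :=
      div_ne_zero (mul_ne_zero hcd hP) (pow_ne_zero 2 hDq)
    exact sub_eq_zero.1 ((mul_eq_zero.1 h6).resolve_left h7)
  constructor
  · refine key _ _ _ ((hlin _ _ _ _ _).symm.trans (hzero (fieldX c d (u, v, u₁, v₁) s))) ?_
    have := M_fieldX (d := d) (u := u) (v := v) (u₁ := u₁) hc h2 hDq
    rwa [hM0, mul_zero] at this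
  · refine key _ _ _ ((hlin _ _ _ _ _).symm.trans (hzero (fieldY (u, v, u₁, v₁) s))) ?_
    have := M_fieldY (c := c) (d := d) (u := u) (v := v) (u₁ := u₁) (v₁ := v₁) hDq
    rwa [hM0, mul_zero] at this

/-- The points at which two particular polynomials in `u₁ v₁` and `u v` do not vanish are dense. By
`generic_bracket` the fields `fieldX`, `fieldY` and their bracket are independent there. -/
theorem frequently_generic (c d : ℝ) (hv : q.2.1 ≠ 0) (hv₁ : q.2.2.2 ≠ 0) :
    ∃ᶠ r : Values in 𝓝 q, r.2.2.1 * r.2.2.2 ≠ r.1 * r.2.1 ∧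
      2 * (r.2.2.1 * r.2.2.2) * (r.1 * r.2.1) + (c + d) * (r.2.2.1 * r.2.2.2 + r.1 * r.2.1)
        + 2 * c * d ≠ 0 := by
  obtain ⟨u, v, u₁, v₁⟩ := q
  simp only at hv hv₁
  intro hev
  -- Along `γ` the product `u₁ v₁` grows with speed `1` and `u v` with speed `2`.
  let γ : ℝ → Values := fun t => (u + 2 * t / v, v, u₁ + t / v₁, v₁)
  have hγ : Tendsto γ (𝓝 0) (𝓝 (u, v, u₁, v₁)) := by
    have h1 : Continuous γ := by fun_prop
    have h2 := h1.tendsto 0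
    simpa [γ] using h2
  obtain ⟨ε, hε, hball⟩ := Metric.eventually_nhds_iff_ball.1 (hγ.eventually hev)
  have hz : ∀ k : ℝ, 0 ≤ k → k ≤ 3 → (u₁ * v₁ - u * v - k * (ε / 4)) *
      (2 * (u₁ * v₁ + k * (ε / 4)) * (u * v + 2 * (k * (ε / 4))) +
        (c + d) * (u₁ * v₁ + k * (ε / 4) + (u * v + 2 * (k * (ε / 4)))) + 2 * c * d) = 0 := by
    intro k hk0 hk3
    have h1 := hball (k * (ε / 4)) (by
      rw [Metric.mem_ball, dist_zero_right, Real.norm_of_nonneg (by positivity)]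
      nlinarith)
    have e1 : (u + 2 * (k * (ε / 4)) / v) * v = u * v + 2 * (k * (ε / 4)) := by field_simp
    have e2 : (u₁ + k * (ε / 4) / v₁) * v₁ = u₁ * v₁ + k * (ε / 4) := by field_simp
    simp only [γ, e1, e2] at h1
    by_contra hne
    refine h1 ⟨fun h2 => hne ?_, fun h2 => hne ?_⟩
    · rw [show u₁ * v₁ - u * v - k * (ε / 4) = 0 by linarith, zero_mul]
    · rw [h2, mul_zero]
  -- A cubic polynomial with leading coefficient `-4` has no four equally spaced roots.
  have h3 : ε ^ 3 = 0 := by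
    linear_combination (-8 / 3) * (hz 3 (by norm_num) (by norm_num) - 3 * hz 2 (by norm_num)
      (by norm_num) + 3 * hz 1 (by norm_num) (by norm_num) - hz 0 (by norm_num) (by norm_num))
  exact hε.ne' (pow_eq_zero_iff (by norm_num) |>.1 h3)

theorem contDiffAt_fieldX (hc : c ≠ 0) {z : Values × ℝ} (hz : z.1 ∈ nondegenerateValues d)
    (hs : z.2 ≠ 0) : ContDiffAt ℝ ∞ (fun z : Values × ℝ => fieldX c d z.1 z.2) z := by
  obtain ⟨h1, h2, h3, h4⟩ := hz
  have h5 : z.1.2.2.2 * (z.1.1 * z.1.2.1 + d) ≠ 0 := mul_ne_zero h2 h3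
  have h6 : 2 * c * (z.1.1 * z.1.2.1 + d) * z.2 ≠ 0 :=
    mul_ne_zero (mul_ne_zero (mul_ne_zero two_ne_zero hc) h3) hs
  unfold fieldX
  fun_prop (disch := assumption)

theorem contDiff_fieldY : ContDiff ℝ ∞ (fun z : Values × ℝ => fieldY z.1 z.2) := by
  unfold fieldY
  fun_prop

theorem contDiffAt_slopeX (hc : c ≠ 0) {z : Values × ℝ} (hz : z.1 ∈ nondegenerateValues d) :
    ContDiffAt ℝ ∞ (fun z : Values × ℝ => slopeX c d z.1 z.2) z := by
  obtain ⟨h1, h2, h3, h4⟩ := hz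
  have h6 : 2 * c * (z.1.1 * z.1.2.1 + d) ≠ 0 :=
    (mul_ne_zero (mul_ne_zero two_ne_zero hc) h3)
  unfold slopeX
  fun_prop (disch := assumption)

/-- If `D` is given implicitly at the regular points of an open set, it satisfies the determining
equations at all points of it: the regular points together with the interior of `{M = 0}` are
dense, and the equations are closed conditions. -/
theorem determining_of_regular (hc : c ≠ 0) (hd : d ≠ 0) (hcd : c + d ≠ 0) {Ω : Set Values}
    (hΩ : IsOpen Ω) (hnd : Ω ⊆ nondegenerateValues d) (hD : ContDiffOn ℝ ∞ D Ω)
    (hD0 : ∀ q ∈ Ω, D q ≠ 0)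
    (himp : ∀ q ∈ Ω, Regular c d q (D q) → GivenImplicitlyAt c d D q) (hq : q ∈ Ω) :
    Determining c d D q := by
  have hDat : ∀ r ∈ Ω, ContDiffAt ℝ ∞ D r := fun r hr => hD.contDiffAt (hΩ.mem_nhds hr)
  have hfr : ∃ᶠ r in 𝓝 q, Determining c d D r := by
    have hgen := frequently_generic c d (hnd hq).1 (hnd hq).2.1
    intro hev
    obtain ⟨r₀, ⟨hr₀, -⟩, hev₀, hr₀Ω⟩ :=
      (hgen.and_eventually (hev.eventually_nhds.and (hΩ.mem_nhds hq))).exists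
    refine hev₀.self_of_nhds (determining_of_M_eq_zero hc hd hcd (hnd hr₀Ω) (hD0 _ hr₀Ω)
      ((hDat _ hr₀Ω).differentiableAt (by simp)) ?_)
    have hne : ∀ᶠ r : Values in 𝓝 r₀, r.2.2.1 * r.2.2.2 ≠ r.1 * r.2.1 :=
      (isOpen_ne_fun (by fun_prop) (by fun_prop)).mem_nhds hr₀
    filter_upwards [hne, hev₀, hΩ.mem_nhds hr₀Ω] with r h1 h2 h3
    by_contra hM
    exact h2 (determining_of_givenImplicitlyAt hc hcd (hnd h3) (hD0 r h3) hM
      ((hDat r h3).differentiableAt (by simp)) (himp r h3 ⟨hM, fun h => h1 h.2.symm⟩))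
  have hDq := hDat q hq
  have hgr : ContinuousAt (fun r => (r, D r)) q := continuousAt_id.prodMk hDq.continuousAt
  have hfd : ContinuousAt (fderiv ℝ D) q := (hDq.fderiv_right (m := 0) (by simp)).continuousAt
  have hX : ContinuousAt (fun r => fieldX c d r (D r)) q :=
    (contDiffAt_fieldX (z := (q, D q)) hc (hnd hq) (hD0 q hq)).continuousAt.comp
      (f := fun r => (r, D r)) hgr
  have hY : ContinuousAt (fun r => fieldY r (D r)) q :=
    contDiff_fieldY.continuous.continuousAt.comp (f := fun r => (r, D r)) hgr
  have hsX : ContinuousAt (fun r => slopeX c d r (D r)) q :=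
    (contDiffAt_slopeX (z := (q, D q)) hc (hnd hq)).continuousAt.comp (f := fun r => (r, D r)) hgr
  have hsY : ContinuousAt (fun r => slopeY (D r)) q := by
    unfold slopeY
    exact hDq.continuousAt.sub (hDq.continuousAt.pow 2)
  constructor
  · by_contra hne
    have := ((hfd.clm_apply hX).sub hsX).eventually_ne (sub_ne_zero.2 hne)
    obtain ⟨r, h1, h2⟩ := (hfr.and_eventually this).exists
    exact h2 (sub_eq_zero.2 h1.1)
  · by_contra hne
    have := ((hfd.clm_apply hY).sub hsY).eventually_ne (sub_ne_zero.2 hne)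
    obtain ⟨r, h1, h2⟩ := (hfr.and_eventually this).exists
    exact h2 (sub_eq_zero.2 h1.2)

end graph

/-! ### Solutions of the determining equations are given implicitly -/

section bracket

variable {c d : ℝ} {D : Values → ℝ} {q : Values}

/-- Two linear forms on a four-dimensional space which vanish on the same three independent vectors
are proportional. The condition `hz` is the independence of the three vectors. -/
theorem apply_mul_apply_comm_of_three_zeros {l m : Values →L[ℝ] ℝ} {A G y v₁ z₁ z₂ z₃ : ℝ}
    (hy : y ≠ 0) (hz : z₂ ≠ 0 ∨ z₃ * y - z₁ * v₁ ≠ 0)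
    (hl1 : l (1, 0, A, G) = 0) (hl2 : l (0, y, 0, v₁) = 0) (hl3 : l (0, z₁, z₂, z₃) = 0)
    (hm1 : m (1, 0, A, G) = 0) (hm2 : m (0, y, 0, v₁) = 0) (hm3 : m (0, z₁, z₂, z₃) = 0)
    (a b : Values) : l a * m b = l b * m a := by
  have hcoord : ∀ (k : Values →L[ℝ] ℝ) (a₁ a₂ a₃ a₄ : ℝ), k (a₁, a₂, a₃, a₄) =
      a₁ * k (1, 0, 0, 0) + a₂ * k (0, 1, 0, 0) + a₃ * k (0, 0, 1, 0) + a₄ * k (0, 0, 0, 1) := by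
    intro k a₁ a₂ a₃ a₄
    simp only [← smul_eq_mul, ← map_smul, ← map_add]
    simp
  obtain ⟨a₁, a₂, a₃, a₄⟩ := a
  obtain ⟨b₁, b₂, b₃, b₄⟩ := b
  rw [hcoord] at hl1 hl2 hl3 hm1 hm2 hm3
  rw [hcoord l a₁, hcoord l b₁, hcoord m a₁, hcoord m b₁]
  generalize l (1, 0, 0, 0) = l₁ at *
  generalize l (0, 1, 0, 0) = l₂ at *
  generalize l (0, 0, 1, 0) = l₃ at *
  generalize l (0, 0, 0, 1) = l₄ at *
  generalize m (1, 0, 0, 0) = m₁ at *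
  generalize m (0, 1, 0, 0) = m₂ at *
  generalize m (0, 0, 1, 0) = m₃ at *
  generalize m (0, 0, 0, 1) = m₄ at *
  have h34 : l₃ * m₄ = l₄ * m₃ := by
    have e1 : z₂ * y * l₃ + (z₃ * y - z₁ * v₁) * l₄ = 0 := by
      linear_combination y * hl3 - z₁ * hl2
    have e2 : z₂ * y * m₃ + (z₃ * y - z₁ * v₁) * m₄ = 0 := by
      linear_combination y * hm3 - z₁ * hm2
    rcases hz with h | h
    · refine mul_left_cancel₀ (mul_ne_zero h hy) ?_
      linear_combination m₄ * e1 - l₄ * e2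
    · refine mul_left_cancel₀ h ?_
      linear_combination l₃ * e2 - m₃ * e1
  have hl2' : l₂ = -(v₁ / y) * l₄ := by field_simp; linear_combination hl2
  have hm2' : m₂ = -(v₁ / y) * m₄ := by field_simp; linear_combination hm2
  have hl1' : l₁ = -A * l₃ - G * l₄ := by linear_combination hl1
  have hm1' : m₁ = -A * m₃ - G * m₄ := by linear_combination hm1
  subst hl2' hm2' hl1' hm1'
  generalize v₁ / y = k
  linear_combination ((a₁ * (-A) + a₃) * (b₂ * (-k) - b₁ * G + b₄) -
    (b₁ * (-A) + b₃) * (a₂ * (-k) - a₁ * G + a₄)) * h34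

/-- The bracket of `fieldX` and `fieldY`, restricted to the graph of a solution `D` of the
determining equations. -/
theorem lieBracket_fieldX_fieldY (hc : c ≠ 0) {u v u₁ v₁ : ℝ}
    (hq : (u, v, u₁, v₁) ∈ nondegenerateValues d)
    (hDq : D (u, v, u₁, v₁) ≠ 0) (hD : DifferentiableAt ℝ D (u, v, u₁, v₁))
    (hdet : Determining c d D (u, v, u₁, v₁)) {s : ℝ} (hs : D (u, v, u₁, v₁) = s) :
    VectorField.lieBracket ℝ (fun r => fieldX c d r (D r)) (fun r => fieldY r (D r))
      (u, v, u₁, v₁) =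
    (0, v * slopeX c d (u, v, u₁, v₁) s,
      v * s * (s * (u * v) * (u₁ * v₁ + d) - u₁ * v₁ * (u * v + d)) / (v₁ * (u * v + d) ^ 2),
      (d - c) * v * v₁ / (2 * c * (u * v + d)) *
        ((1 - s ^ 2) * d / (u * v + d) - (1 + s ^ 2) * (1 - s) / s)) := by
  obtain ⟨h1, h2, h3, h4⟩ := hq
  have hgr : DifferentiableAt ℝ (fun r => (r, D r)) (u, v, u₁, v₁) :=
    differentiableAt_id.prodMk hD
  have hX : DifferentiableAt ℝ (fun r => fieldX c d r (D r)) (u, v, u₁, v₁) :=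
    DifferentiableAt.comp (f := fun r => (r, D r)) _
      ((contDiffAt_fieldX (d := d) (z := ((u, v, u₁, v₁), D (u, v, u₁, v₁))) hc
        ⟨h1, h2, h3, h4⟩ hDq).differentiableAt (by simp)) hgr
  have hY : DifferentiableAt ℝ (fun r => fieldY r (D r)) (u, v, u₁, v₁) :=
    DifferentiableAt.comp (f := fun r => (r, D r)) _
      (contDiff_fieldY.differentiable (by simp) _) hgr
  obtain ⟨hdX, hdY⟩ := hdet
  rw [hs] at hdX hdY hDq
  rw [VectorField.lieBracket]
  simp only [hs]
  have eY : fderiv ℝ (fun r => fieldY r (D r)) (u, v, u₁, v₁) (fieldX c d (u, v, u₁, v₁) s) =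
      (0, v * slopeX c d (u, v, u₁, v₁) s, 0,
        (d - c) * v * v₁ * (s ^ 2 - 1) / (2 * c * (u * v + d) * s)) := by
    refine (hasDerivAt_comp_line hY (fieldX c d (u, v, u₁, v₁) s)).unique ?_
    have hσ := hasDerivAt_comp_line hD (fieldX c d (u, v, u₁, v₁) s)
    rw [hdX] at hσ
    have := (hasDerivAt_const (0 : ℝ) (0 : ℝ)).prodMk
      (((hasDerivAt_line v 0).mul hσ).prodMk ((hasDerivAt_const (0 : ℝ) (0 : ℝ)).prodMk
        (hasDerivAt_line v₁ ((d - c) * v * v₁ * (s ^ 2 - 1) / (2 * c * (u * v + d) * s)))))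
    refine this.congr_deriv ?_
    simp
  have eX : fderiv ℝ (fun r => fieldX c d r (D r)) (u, v, u₁, v₁) (fieldY (u, v, u₁, v₁) s) =
      (0, 0, -(v * s * (s * (u * v) * (u₁ * v₁ + d) - u₁ * v₁ * (u * v + d)) /
          (v₁ * (u * v + d) ^ 2)),
        (d - c) * v * v₁ * (s ^ 2 - 1) / (2 * c * (u * v + d) * s) -
        (d - c) * v * v₁ / (2 * c * (u * v + d)) *
        ((1 - s ^ 2) * d / (u * v + d) - (1 + s ^ 2) * (1 - s) / s)) := by
    refine (hasDerivAt_comp_line hX (fieldY (u, v, u₁, v₁) s)).unique ?_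
    have hσ := hasDerivAt_comp_line hD (fieldY (u, v, u₁, v₁) s)
    rw [hdY] at hσ
    have hσ0 : D ((u, v, u₁, v₁) + (0 : ℝ) • fieldY (u, v, u₁, v₁) s) = s := by simpa using hs
    have hu := hasDerivAt_line u 0
    have hv := hasDerivAt_line v (v * s)
    have hu₁ := hasDerivAt_line u₁ 0
    have hv₁ := hasDerivAt_line v₁ v₁
    have hQ := (hu.mul hv).add_const d
    have n1 : (v₁ + 0 * v₁) * ((u + 0 * 0) * (v + 0 * (v * s)) + d) ≠ 0 := by simpa using ⟨h2, h3⟩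
    have n2 : 2 * c * ((u + 0 * 0) * (v + 0 * (v * s)) + d) *
        D ((u, v, u₁, v₁) + (0 : ℝ) • fieldY (u, v, u₁, v₁) s) ≠ 0 := by
      simpa [hs] using ⟨⟨hc, h3⟩, hDq⟩
    have := (hasDerivAt_const (0 : ℝ) (1 : ℝ)).prodMk
      ((hasDerivAt_const (0 : ℝ) (0 : ℝ)).prodMk
      ((((hv.mul ((hu₁.mul hv₁).add_const d)).mul hσ).div (hv₁.mul hQ) n1).prodMk
      ((((hv.const_mul (d - c)).mul hv₁).mul ((hσ.pow 2).sub_const 1)).div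
        ((hQ.const_mul (2 * c)).mul hσ) n2)))
    refine this.congr_deriv ?_
    simp only [Pi.mul_apply, Pi.pow_apply, hσ0, zero_mul, mul_zero, add_zero, slopeY]
    have h3' : v * u + d ≠ 0 := by rwa [mul_comm]
    refine Prod.ext rfl (Prod.ext rfl (Prod.ext ?_ ?_))
    · simp only
      field_simp
      ring
    · simp only
      push_cast
      field_simp
      ring
  rw [eY, eX]
  simp

/-- At the generic points of `frequently_generic` the bracket is independent of `fieldX` and
`fieldY`. If it is not, then `s` can be eliminated and one of the two polynomials vanishes. -/
theorem generic_bracket {u v u₁ v₁ s : ℝ} (hc : c ≠ 0) (hd : d ≠ 0)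
    (hq : (u, v, u₁, v₁) ∈ nondegenerateValues d) (hs : s ≠ 0)
    (hne : u₁ * v₁ ≠ u * v)
    (hR : 2 * (u₁ * v₁) * (u * v) + (c + d) * (u₁ * v₁ + u * v) + 2 * c * d ≠ 0) :
    v * s * (s * (u * v) * (u₁ * v₁ + d) - u₁ * v₁ * (u * v + d)) / (v₁ * (u * v + d) ^ 2) ≠ 0 ∨
      ((d - c) * v * v₁ / (2 * c * (u * v + d)) *
        ((1 - s ^ 2) * d / (u * v + d) - (1 + s ^ 2) * (1 - s) / s)) * (v * s) -
        v * slopeX c d (u, v, u₁, v₁) s * v₁ ≠ 0 := by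
  obtain ⟨h1, h2, h3, h4⟩ := hq
  by_contra! hcon
  obtain ⟨e1, e2⟩ := hcon
  have h3' : v * u + d ≠ 0 := by rwa [mul_comm]
  have e1' : s * (u * v) * (u₁ * v₁ + d) = u₁ * v₁ * (u * v + d) := by
    have h5 : v * s / (v₁ * (u * v + d) ^ 2) ≠ 0 := by positivity
    refine sub_eq_zero.1 ((mul_eq_zero.1 (?_ : v * s / (v₁ * (u * v + d) ^ 2) *
      (s * (u * v) * (u₁ * v₁ + d) - u₁ * v₁ * (u * v + d)) = 0)).resolve_left h5)
    rw [← e1]; ring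
  have e2' : (1 - s) * (2 * c * (u * v + d) + (d - c) * (1 + s) * (u * v)) = 0 := by
    have h5 : v ^ 2 * v₁ * s / (2 * c * (u * v + d) ^ 2) ≠ 0 := by positivity
    refine (mul_eq_zero.1 (?_ : v ^ 2 * v₁ * s / (2 * c * (u * v + d) ^ 2) * ((1 - s) *
      (2 * c * (u * v + d) + (d - c) * (1 + s) * (u * v))) = 0)).resolve_left h5
    rw [← neg_eq_zero, ← e2]
    simp only [slopeX]
    field_simp
    ring
  rcases mul_eq_zero.1 e2' with h | h
  · have hs1 : s = 1 := by linarith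
    subst hs1
    exact hne (mul_left_cancel₀ hd (by linear_combination -e1'))
  · refine hR (mul_left_cancel₀ hd ?_)
    linear_combination (u₁ * v₁ + d) * h - (d - c) * e1'

/-- Any two functions constant along `fieldX` and `fieldY` are constant along the bracket as well,
so their differentials are proportional at generic points, and by continuity everywhere. -/
theorem fderiv_invariants_comm (hc : c ≠ 0) (hd : d ≠ 0) {φ ψ : Values → ℝ}
    (hφ : ∀ᶠ r in 𝓝 q, ContDiffAt ℝ ∞ φ r) (hψ : ∀ᶠ r in 𝓝 q, ContDiffAt ℝ ∞ ψ r)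
    (hD : ∀ᶠ r in 𝓝 q, ContDiffAt ℝ ∞ D r) (hq : q ∈ nondegenerateValues d) (hDq : D q ≠ 0)
    (hdet : ∀ᶠ r in 𝓝 q, Determining c d D r)
    (hφX : ∀ᶠ r in 𝓝 q, fderiv ℝ φ r (fieldX c d r (D r)) = 0)
    (hφY : ∀ᶠ r in 𝓝 q, fderiv ℝ φ r (fieldY r (D r)) = 0)
    (hψX : ∀ᶠ r in 𝓝 q, fderiv ℝ ψ r (fieldX c d r (D r)) = 0)
    (hψY : ∀ᶠ r in 𝓝 q, fderiv ℝ ψ r (fieldY r (D r)) = 0) :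
    ∀ᶠ r in 𝓝 q, ∀ a b, fderiv ℝ φ r a * fderiv ℝ ψ r b = fderiv ℝ φ r b * fderiv ℝ ψ r a := by
  have hbr : ∀ {χ : Values → ℝ} {r : Values}, ContDiffAt ℝ ∞ χ r → ContDiffAt ℝ ∞ D r →
      r ∈ nondegenerateValues d → D r ≠ 0 →
      (∀ᶠ r in 𝓝 r, fderiv ℝ χ r (fieldX c d r (D r)) = 0) →
      (∀ᶠ r in 𝓝 r, fderiv ℝ χ r (fieldY r (D r)) = 0) →
      fderiv ℝ χ r (VectorField.lieBracket ℝ (fun r => fieldX c d r (D r))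
        (fun r => fieldY r (D r)) r) = 0 := by
    intro χ r hχ hDr hr hDr0 hX hY
    have hgr : DifferentiableAt ℝ (fun r => (r, D r)) r :=
      differentiableAt_id.prodMk (hDr.differentiableAt (by simp))
    have hX' : DifferentiableAt ℝ (fun r => fieldX c d r (D r)) r :=
      DifferentiableAt.comp (f := fun r => (r, D r)) _
        ((contDiffAt_fieldX (d := d) (z := (r, D r)) hc hr hDr0).differentiableAt (by simp)) hgr
    have hY' : DifferentiableAt ℝ (fun r => fieldY r (D r)) r :=
      DifferentiableAt.comp (f := fun r => (r, D r)) _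
        (contDiff_fieldY.differentiable (by simp) _) hgr
    rw [VectorField.fderiv_apply_lieBracket (n := (2 : ℕ)) (contDiffAt_infty.1 hχ 2)
      (by simp)
      hY' hX']
    have h1 : (fun r => fderiv ℝ χ r (fieldX c d r (D r))) =ᶠ[𝓝 r] fun _ => 0 := hX
    have h2 : (fun r => fderiv ℝ χ r (fieldY r (D r))) =ᶠ[𝓝 r] fun _ => 0 := hY
    rw [h1.fderiv_eq, h2.fderiv_eq]
    simp
  have hD0 : ∀ᶠ r in 𝓝 q, D r ≠ 0 := hD.self_of_nhds.continuousAt.eventually_ne hDq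
  have hnd : ∀ᶠ r in 𝓝 q, r ∈ nondegenerateValues d := (isOpen_nondegenerateValues d).mem_nhds hq
  have hgeneric : ∀ᶠ r in 𝓝 q, (r.2.2.1 * r.2.2.2 ≠ r.1 * r.2.1 ∧
      2 * (r.2.2.1 * r.2.2.2) * (r.1 * r.2.1) + (c + d) * (r.2.2.1 * r.2.2.2 + r.1 * r.2.1)
        + 2 * c * d ≠ 0) →
      ∀ a b, fderiv ℝ φ r a * fderiv ℝ ψ r b = fderiv ℝ φ r b * fderiv ℝ ψ r a := by
    filter_upwards [hφ, hψ, hD, hD0, hnd, hdet, hφX.eventually_nhds, hφY.eventually_nhds,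
      hψX.eventually_nhds, hψY.eventually_nhds] with r h1 h2 h3 h4 h5 h6 h7 h8 h9 h10 ⟨hne, hR⟩
    have b1 := hbr h1 h3 h5 h4 h7 h8
    have b2 := hbr h2 h3 h5 h4 h9 h10
    have h7 := h7.self_of_nhds
    have h8 := h8.self_of_nhds
    have h9 := h9.self_of_nhds
    have h10 := h10.self_of_nhds
    obtain ⟨u, v, u₁, v₁⟩ := r
    rw [lieBracket_fieldX_fieldY hc h5 h4 (h3.differentiableAt (by simp)) h6 rfl] at b1 b2
    exact apply_mul_apply_comm_of_three_zeros (mul_ne_zero h5.1 h4)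
      (generic_bracket hc hd h5 h4 hne hR) h7 h8 b1 h9 h10 b2
  filter_upwards [hgeneric.eventually_nhds, hφ, hψ, hnd] with r h1 h2 h3 h4 a b
  by_contra hab
  have c1 : ContinuousAt (fderiv ℝ φ) r := (h2.fderiv_right (m := 0) (by simp)).continuousAt
  have c2 : ContinuousAt (fderiv ℝ ψ) r := (h3.fderiv_right (m := 0) (by simp)).continuousAt
  have c3 : ContinuousAt (fun r => fderiv ℝ φ r a * fderiv ℝ ψ r b -
      fderiv ℝ φ r b * fderiv ℝ ψ r a) r :=
    ((c1.clm_apply continuousAt_const).mul (c2.clm_apply continuousAt_const)).sub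
      ((c1.clm_apply continuousAt_const).mul (c2.clm_apply continuousAt_const))
  obtain ⟨r', h5, h6, h7⟩ := ((frequently_generic c d h4.1 h4.2.1).and_eventually
    (h1.and (c3.eventually_ne (sub_ne_zero.2 hab)))).exists
  exact h7 (sub_eq_zero.2 (h6 h5 a b))

/-- On the graph of a solution `D` of the determining equations, `K₂` and `L₂` are functionally
dependent, and not both stationary at a regular point. So one of them is a smooth function of
the other, and `H` is the difference of the two sides of that relation. -/
theorem givenImplicitlyAt_of_determining (hc : c ≠ 0) (hd : d ≠ 0) (hcd : c + d ≠ 0)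
    (hD : ∀ᶠ r in 𝓝 q, ContDiffAt ℝ ∞ D r) (hq : q ∈ nondegenerateValues d) (hDq : D q ≠ 0)
    (hdet : ∀ᶠ r in 𝓝 q, Determining c d D r) (hreg : Regular c d q (D q)) :
    GivenImplicitlyAt c d D q := by
  have hDat := hD.self_of_nhds
  have hgr : ContinuousAt (fun r => (r, D r)) q := continuousAt_id.prodMk hDat.continuousAt
  have hM : M c d q (D q) ≠ 0 := hreg.1
  have hMev : ∀ᶠ r in 𝓝 q, M c d r (D r) ≠ 0 :=
    ((contDiffAt_M c d (z := (q, D q)) hDq).continuousAt.comp (f := fun r => (r, D r))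
      hgr).eventually_ne hM
  have hD0 : ∀ᶠ r in 𝓝 q, D r ≠ 0 := hDat.continuousAt.eventually_ne hDq
  have hnd : ∀ᶠ r in 𝓝 q, r ∈ nondegenerateValues d := (isOpen_nondegenerateValues d).mem_nhds hq
  set φ : Values → ℝ := fun r => K₂ c d r (D r) with hφdef
  set ψ : Values → ℝ := fun r => L₂ c d r (D r) with hψdef
  have hφ : ∀ᶠ r in 𝓝 q, ContDiffAt ℝ ∞ φ r := by
    filter_upwards [hD, hMev, hD0, hnd] with r h1 h2 h3 h4
    exact (contDiffAt_K₂ c d (z := (r, D r)) h4.1 h3 h2).comp (f := fun r => (r, D r)) r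
      (contDiffAt_id.prodMk h1)
  have hψ : ∀ᶠ r in 𝓝 q, ContDiffAt ℝ ∞ ψ r := by
    filter_upwards [hD, hMev, hD0, hnd] with r h1 h2 h3 h4
    exact (contDiffAt_L₂ c d (z := (r, D r)) h4.2.1 h3 h2).comp (f := fun r => (r, D r)) r
      (contDiffAt_id.prodMk h1)
  have hφ' : ∀ᶠ r in 𝓝 q, ∀ a, fderiv ℝ φ r a =
      fderiv ℝ (fun z : Values × ℝ => K₂ c d z.1 z.2) (r, D r) (a, fderiv ℝ D r a) := by
    filter_upwards [hD, hMev, hD0, hnd] with r h1 h2 h3 h4 a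
    exact fderiv_comp_graph_apply ((contDiffAt_K₂ c d (z := (r, D r)) h4.1 h3 h2).differentiableAt
      (by simp)) (h1.differentiableAt (by simp)) a
  have hψ' : ∀ᶠ r in 𝓝 q, ∀ a, fderiv ℝ ψ r a =
      fderiv ℝ (fun z : Values × ℝ => L₂ c d z.1 z.2) (r, D r) (a, fderiv ℝ D r a) := by
    filter_upwards [hD, hMev, hD0, hnd] with r h1 h2 h3 h4 a
    exact fderiv_comp_graph_apply ((contDiffAt_L₂ c d (z := (r, D r)) h4.2.1 h3 h2).differentiableAt
      (by simp)) (h1.differentiableAt (by simp)) a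
  have hcomm := fderiv_invariants_comm hc hd hφ hψ hD hq hDq hdet
    (by
      filter_upwards [hφ', hdet, hMev, hD0, hnd] with ⟨u, v, u₁, v₁⟩ h1 h2 h3 h4 h5
      rw [h1, h2.1, K₂_fieldX hc hcd h5.1 h5.2.1 h4 h5.2.2.1 h3])
    (by
      filter_upwards [hφ', hdet, hMev, hD0, hnd] with ⟨u, v, u₁, v₁⟩ h1 h2 h3 h4 h5
      rw [h1, h2.2, K₂_fieldY h5.1 h4 h3])
    (by
      filter_upwards [hψ', hdet, hMev, hD0, hnd] with ⟨u, v, u₁, v₁⟩ h1 h2 h3 h4 h5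
      rw [h1, h2.1, L₂_fieldX hc hcd h5.2.1 h4 h3])
    (by
      filter_upwards [hψ', hdet, hMev, hD0, hnd] with ⟨u, v, u₁, v₁⟩ h1 h2 h3 h4 h5
      rw [h1, h2.2, L₂_fieldY h5.2.1 h4 h3])
  have hφq := hφ'.self_of_nhds
  have hψq := hψ'.self_of_nhds
  have hind : ∀ {α β : ℝ}, (∀ w, α * fderiv ℝ (fun z : Values × ℝ => K₂ c d z.1 z.2) (q, D q) w +
      β * fderiv ℝ (fun z : Values × ℝ => L₂ c d z.1 z.2) (q, D q) w = 0) → α = 0 ∧ β = 0 := by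
    obtain ⟨u, v, u₁, v₁⟩ := q
    exact fun h => eq_zero_of_fderiv_combination hc hd hq.1 hq.2.1 hDq hreg h
  have hsplit : ∀ (l : Values × ℝ →L[ℝ] ℝ) (w : Values × ℝ), l w =
      l (w.1, fderiv ℝ D q w.1) + (w.2 - fderiv ℝ D q w.1) * l (0, 1) := by
    intro l w
    rw [← smul_eq_mul, ← map_smul, ← map_add]
    simp
  -- `H` only has to be a submersion: transversality of the graph to `∂_s` does the rest.
  have main : ∀ (V : Set (ℝ × ℝ)) (H : ℝ × ℝ → ℝ), IsOpen V → ContDiffOn ℝ ∞ H V →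
      (φ q, ψ q) ∈ V → (∀ᶠ r in 𝓝 q, H (φ r, ψ r) = 0) → fderiv ℝ H (φ q, ψ q) ≠ 0 →
      GivenImplicitlyAt c d D q := by
    intro V H hV hH hmem hev hne
    refine ⟨V, H, hV, hH, hmem, hev, fun h0 => hne ?_⟩
    have hF := hasFDerivAt_comp_invariants hq hDq hM
      (((hH.contDiffAt (hV.mem_nhds hmem)).differentiableAt (by simp)))
    rw [deriv_eq_fderiv_snd hF.differentiableAt] at h0
    have hgraph : ∀ a, fderiv ℝ (fun z : Values × ℝ => H (K₂ c d z.1 z.2, L₂ c d z.1 z.2))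
        (q, D q) (a, fderiv ℝ D q a) = 0 := by
      intro a
      rw [← fderiv_comp_graph_apply hF.differentiableAt (hDat.differentiableAt (by simp))]
      have h1 : (fun r => H (K₂ c d r (D r), L₂ c d r (D r))) =ᶠ[𝓝 q] fun _ => 0 := hev
      rw [h1.fderiv_eq]
      simp
    have hlin : ∀ x y : ℝ, fderiv ℝ H (φ q, ψ q) (x, y) =
        fderiv ℝ H (φ q, ψ q) (1, 0) * x + fderiv ℝ H (φ q, ψ q) (0, 1) * y := by
      intro x y
      rw [mul_comm _ x, mul_comm _ y, ← smul_eq_mul, ← smul_eq_mul, ← map_smul, ← map_smul,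
        ← map_add]
      simp
    have h2 := hind (α := fderiv ℝ H (φ q, ψ q) (1, 0)) (β := fderiv ℝ H (φ q, ψ q) (0, 1)) (by
      intro w
      rw [← hlin]
      have h3 := hsplit (fderiv ℝ (fun z : Values × ℝ => H (K₂ c d z.1 z.2, L₂ c d z.1 z.2))
        (q, D q)) w
      rw [hgraph, h0, mul_zero, add_zero, hF.fderiv] at h3
      exact h3)
    ext
    · simpa using h2.1
    · simpa using h2.2
  by_cases h0 : fderiv ℝ φ q = 0
  · by_cases h1 : fderiv ℝ ψ q = 0
    -- If both were stationary, `dK₂` and `dL₂` would both be multiples of `ds - dD`.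
    · exfalso
      have hz := hind
        (α := fderiv ℝ (fun z : Values × ℝ => L₂ c d z.1 z.2) (q, D q) (0, 1))
        (β := -fderiv ℝ (fun z : Values × ℝ => K₂ c d z.1 z.2) (q, D q) (0, 1)) (by
        intro w
        rw [hsplit _ w, hsplit (fderiv ℝ (fun z : Values × ℝ => L₂ c d z.1 z.2) (q, D q)) w,
          ← hφq, ← hψq, h0, h1]
        simp
        ring)
      have h2 := hind (α := 1) (β := 0) (by
        intro w
        rw [hsplit _ w, ← hφq, h0, neg_eq_zero.1 hz.2]
        simp)
      exact one_ne_zero h2.1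
    · obtain ⟨V, h, hV, hmem, hh, hev⟩ := exists_eventually_eq_comp hψ hφ h1
        (hcomm.mono fun r hr a b => by linarith [hr b a])
      refine main (Prod.snd ⁻¹' V) (fun p => p.1 - h p.2) (hV.preimage continuous_snd)
        (contDiffOn_fst.sub (hh.comp contDiffOn_snd fun _ hp => hp)) hmem
        (hev.mono fun r hr => sub_eq_zero.2 hr) fun hcon => ?_
      have h2 := ((hh.contDiffAt (hV.mem_nhds hmem)).differentiableAt (by simp)).hasFDerivAt
      have h3 := (hasFDerivAt_fst (𝕜 := ℝ) (p := (φ q, ψ q))).sub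
        (HasFDerivAt.comp (φ q, ψ q) (f := Prod.snd) h2 hasFDerivAt_snd)
      have h4 := DFunLike.congr_fun (h3.fderiv.symm.trans hcon) (1, 0)
      simp at h4
  · obtain ⟨V, h, hV, hmem, hh, hev⟩ := exists_eventually_eq_comp hφ hψ h0 hcomm
    refine main (Prod.fst ⁻¹' V) (fun p => p.2 - h p.1) (hV.preimage continuous_fst)
      (contDiffOn_snd.sub (hh.comp contDiffOn_fst fun _ hp => hp)) hmem
      (hev.mono fun r hr => sub_eq_zero.2 hr) fun hcon => ?_
    have h2 := ((hh.contDiffAt (hV.mem_nhds hmem)).differentiableAt (by simp)).hasFDerivAt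
    have h3 := (hasFDerivAt_snd (𝕜 := ℝ) (p := (φ q, ψ q))).sub
      (HasFDerivAt.comp (φ q, ψ q) (f := Prod.fst) h2 hasFDerivAt_fst)
    have h4 := DFunLike.congr_fun (h3.fderiv.symm.trans hcon) (0, 1)
    simp at h4

end bracket

/-! ### Solutions of the semi-discrete system -/

section solutions

variable {U : Set Args} {f g : Args → ℝ} {a b x : ℝ} {u v u₁ v₁ : ℝ → ℝ}

theorem hasDerivAt_of_contDiffOn_two {w : ℝ → ℝ} (hw : ContDiffOn ℝ 2 w (Set.Ioo a b))
    (hx : x ∈ Set.Ioo a b) : HasDerivAt w (deriv w x) x :=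
  ((hw.contDiffAt (isOpen_Ioo.mem_nhds hx)).differentiableAt (by simp)).hasDerivAt

theorem hasDerivAt_deriv_of_contDiffOn_two {w : ℝ → ℝ} (hw : ContDiffOn ℝ 2 w (Set.Ioo a b))
    (hx : x ∈ Set.Ioo a b) : HasDerivAt (deriv w) (deriv (deriv w) x) x := by
  have h1 : ContDiffOn ℝ (1 + 1) w (Set.Ioo a b) := by rwa [one_add_one_eq_two]
  have h2 := ((contDiffOn_succ_iff_deriv_of_isOpen isOpen_Ioo).1 h1).2.2
  exact ((h2.contDiffAt (isOpen_Ioo.mem_nhds hx)).differentiableAt (by simp)).hasDerivAt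

theorem IsSolutionOn.hasDerivAt_argsAt (h : IsSolutionOn U f g a b u v u₁ v₁)
    (hx : x ∈ Set.Ioo a b) :
    HasDerivAt (argsAt u v u₁ v₁) (1, (deriv u x, deriv v x, f (argsAt u v u₁ v₁ x),
      g (argsAt u v u₁ v₁ x)), (deriv (deriv u) x, deriv (deriv v) x)) x := by
  rw [← h.eq_u x hx, ← h.eq_v x hx]
  exact (hasDerivAt_id x).prodMk (((hasDerivAt_of_contDiffOn_two h.smooth_u hx).prodMk
    ((hasDerivAt_of_contDiffOn_two h.smooth_v hx).prodMk
      ((hasDerivAt_of_contDiffOn_two h.smooth_u₁ hx).prodMk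
        (hasDerivAt_of_contDiffOn_two h.smooth_v₁ hx)))).prodMk
    ((hasDerivAt_deriv_of_contDiffOn_two h.smooth_u hx).prodMk
      (hasDerivAt_deriv_of_contDiffOn_two h.smooth_v hx)))

theorem IsSolutionOn.deriv_deriv (hU : IsOpen U) (hf : ContDiffOn ℝ ∞ f U)
    (h : IsSolutionOn U f g a b u v u₁ v₁) (hx : x ∈ Set.Ioo a b) :
    deriv (deriv u₁) x = fderiv ℝ f (argsAt u v u₁ v₁ x) (1, (deriv u x, deriv v x,
      f (argsAt u v u₁ v₁ x), g (argsAt u v u₁ v₁ x)),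
      (deriv (deriv u) x, deriv (deriv v) x)) := by
  have h1 : deriv u₁ =ᶠ[𝓝 x] f ∘ argsAt u v u₁ v₁ := by
    filter_upwards [isOpen_Ioo.mem_nhds hx] with y hy
    exact h.eq_u y hy
  rw [h1.deriv_eq]
  have h2 := (hf.contDiffAt (hU.mem_nhds (h.mem x hx))).differentiableAt (by simp)
  exact (h2.hasFDerivAt.comp_hasDerivAt x (h.hasDerivAt_argsAt hx)).deriv

/-- Through every point of `U` passes a solution with prescribed second derivatives of `u, v`:
take `u, v` to be quadratic polynomials and solve the system for `u₁, v₁`. -/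
theorem exists_isSolutionOn (hU : IsOpen U) (hf : ContDiffOn ℝ ∞ f U) (hg : ContDiffOn ℝ ∞ g U)
    {p : Args} (hp : p ∈ U) (uxx vxx : ℝ) :
    ∃ (a b : ℝ) (u v u₁ v₁ : ℝ → ℝ), IsSolutionOn U f g a b u v u₁ v₁ ∧ p.1 ∈ Set.Ioo a b ∧
      argsAt u v u₁ v₁ p.1 = p ∧ deriv (deriv u) p.1 = uxx ∧ deriv (deriv v) p.1 = vxx := by
  obtain ⟨x₀, ⟨u0, v0, u10, v10⟩, ux, vx⟩ := p
  have hquad : ∀ y y' y'' : ℝ, ∃ w : ℝ → ℝ, ContDiff ℝ ∞ w ∧ w x₀ = y ∧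
      deriv w = (fun x => y' + y'' * (x - x₀)) ∧ deriv (deriv w) x₀ = y'' := by
    intro y y' y''
    have h1 : deriv (fun x => y + y' * (x - x₀) + y'' / 2 * (x - x₀) ^ 2) =
        fun x => y' + y'' * (x - x₀) := by
      ext x
      have hx := (hasDerivAt_id x).sub_const x₀
      have := (((hx.const_mul y').const_add y).add ((hx.pow 2).const_mul (y'' / 2))).deriv
      refine this.trans ?_
      simp
      ring
    refine ⟨fun x => y + y' * (x - x₀) + y'' / 2 * (x - x₀) ^ 2, by fun_prop, by simp, h1, ?_⟩
    simp [h1]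
  obtain ⟨u, hu, hu0, hu', hu''⟩ := hquad u0 ux uxx
  obtain ⟨v, hv, hv0, hv', hv''⟩ := hquad v0 vx vxx
  let E : ℝ × ℝ × ℝ → Args := fun z => (z.1, (u z.1, v z.1, z.2.1, z.2.2),
    (ux + uxx * (z.1 - x₀), vx + vxx * (z.1 - x₀)))
  have hE : ContDiff ℝ ∞ E := by
    have := hu.comp (contDiff_fst (E := ℝ) (F := ℝ × ℝ))
    have := hv.comp (contDiff_fst (E := ℝ) (F := ℝ × ℝ))
    fun_prop
  have hE0 : E (x₀, u10, v10) = (x₀, (u0, v0, u10, v10), (ux, vx)) := by simp [E, hu0, hv0]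
  let F : ℝ × ℝ × ℝ → ℝ × ℝ × ℝ := fun z => (1, f (E z), g (E z))
  have hF : ContDiffOn ℝ ∞ F (E ⁻¹' U) :=
    contDiffOn_const.prodMk ((hf.comp hE.contDiffOn fun _ hz => hz).prodMk
      (hg.comp hE.contDiffOn fun _ hz => hz))
  have hopen : IsOpen (E ⁻¹' U) := hU.preimage hE.continuous
  have hmem0 : (x₀, u10, v10) ∈ E ⁻¹' U := by
    rw [Set.mem_preimage, hE0]
    exact hp
  obtain ⟨α, hα0, ε, hε, hα⟩ :=
    ((hF.contDiffAt (hopen.mem_nhds hmem0)).of_le (by simp)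
      ).exists_forall_mem_closedBall_exists_eq_forall_mem_Ioo_hasDerivAt₀ x₀
  have hαc : Tendsto α (𝓝 x₀) (𝓝 (x₀, u10, v10)) := by
    have := (hα x₀ ⟨by linarith, by linarith⟩).continuousAt
    rwa [ContinuousAt, hα0] at this
  obtain ⟨δ, hδ, hαU⟩ := Metric.eventually_nhds_iff_ball.1 (hαc (hopen.mem_nhds hmem0))
  set S : Set ℝ := Set.Ioo (x₀ - min ε δ) (x₀ + min ε δ) with hS
  have hSo : IsOpen S := isOpen_Ioo
  have hx₀ : x₀ ∈ S := ⟨by have := lt_min hε hδ; linarith, by have := lt_min hε hδ; linarith⟩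
  have hαS : ∀ t ∈ S, HasDerivAt α (F (α t)) t := fun t ht => hα t
    ⟨by have := min_le_left ε δ; linarith [ht.1], by have := min_le_left ε δ; linarith [ht.2]⟩
  have hmem : ∀ t ∈ S, α t ∈ E ⁻¹' U := fun t ht => hαU t (by
    rw [Real.ball_eq_Ioo]
    exact ⟨by have := min_le_right ε δ; linarith [ht.1],
      by have := min_le_right ε δ; linarith [ht.2]⟩)
  -- The first component of the autonomous system is the independent variable itself.
  have hfst : ∀ t ∈ S, (α t).1 = t := by
    intro t ht
    have hd : ∀ t ∈ S, HasDerivAt (fun t => (α t).1 - t) 0 t := fun t ht => by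
      have h1 : HasDerivAt (fun t => (α t).1) 1 t :=
        (hasFDerivAt_fst (𝕜 := ℝ) (p := α t)).comp_hasDerivAt t (hαS t ht)
      exact (h1.sub (hasDerivAt_id t)).congr_deriv (sub_self 1)
    have := hSo.is_const_of_deriv_eq_zero isPreconnected_Ioo
      (fun t ht => (hd t ht).differentiableAt.differentiableWithinAt)
      (fun t ht => (hd t ht).deriv) ht hx₀
    simp only [hα0, sub_self] at this
    linarith
  have hstep : ∀ n : ℕ, ContDiffOn ℝ n α S → ContDiffOn ℝ (n + 1) α S := by
    intro n hn
    refine (contDiffOn_succ_iff_deriv_of_isOpen hSo).2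
      ⟨fun t ht => (hαS t ht).differentiableAt.differentiableWithinAt, by simp, ?_⟩
    exact ((contDiffOn_infty.1 hF n).comp hn hmem).congr fun t ht => (hαS t ht).deriv
  have hα2 : ContDiffOn ℝ 2 α S := by
    have h0 : ContDiffOn ℝ (0 : ℕ) α S := by
      rw [Nat.cast_zero, contDiffOn_zero]
      exact fun t ht => (hαS t ht).continuousAt.continuousWithinAt
    have h1 : ContDiffOn ℝ (1 : ℕ) α S := by simpa using hstep 0 h0
    have h2 := hstep 1 h1
    rwa [Nat.cast_one, one_add_one_eq_two] at h2
  have hargs : ∀ t ∈ S, argsAt u v (fun t => (α t).2.1) (fun t => (α t).2.2) t = E (α t) := by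
    intro t ht
    simp only [argsAt, E, hu', hv', hfst t ht]
  refine ⟨x₀ - min ε δ, x₀ + min ε δ, u, v, fun t => (α t).2.1, fun t => (α t).2.2,
    ⟨(contDiff_infty.1 hu 2).contDiffOn, (contDiff_infty.1 hv 2).contDiffOn,
      hα2.snd.fst, hα2.snd.snd, fun t ht => ?_, fun t ht => ?_, fun t ht => ?_⟩, hx₀, ?_,
      hu'', hv''⟩
  · rw [hargs t ht]
    exact hmem t ht
  · rw [hargs t ht]
    exact ((hasFDerivAt_fst (𝕜 := ℝ) (p := (α t).2)).comp_hasDerivAt t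
      ((hasFDerivAt_snd (𝕜 := ℝ) (p := α t)).comp_hasDerivAt t (hαS t ht))).deriv
  · rw [hargs t ht]
    exact ((hasFDerivAt_snd (𝕜 := ℝ) (p := (α t).2)).comp_hasDerivAt t
      ((hasFDerivAt_snd (𝕜 := ℝ) (p := α t)).comp_hasDerivAt t (hαS t ht))).deriv
  · rw [hargs x₀ hx₀, hα0, hE0]

end solutions

/-! ### The required form implies the two integrals -/

section sufficiency

variable {c d : ℝ}

theorem I₂_eq (hc : c ≠ 0) {x x' : ℝ} {n n' : ℕ} {u v u₁ v₁ ux vx s : ℝ} {y y' : ℝ × ℝ}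
    (hv : v ≠ 0) (hv₁ : v₁ ≠ 0) (hQ : u * v + d ≠ 0) (hP : u₁ * v₁ + d ≠ 0) (hs : s ≠ 0) {p : Args}
    (hp : p = (x, (u, v, u₁, v₁), (ux, vx))) :
    I₂ c d x n ((u₁, v₁), (rhsU d s p, rhsV c d s p), y) =
      I₂ c d x' n' ((u, v), (ux, vx), y') := by
  subst hp
  simp only [I₂, rhsU, rhsV]
  have h3' : v * u + d ≠ 0 := by rwa [mul_comm]
  have h4' : v₁ * u₁ + d ≠ 0 := by rwa [mul_comm]
  field_simp
  ring

/-- The `x`-derivative of `(u, v, u₁, v₁)` along a solution, in terms of `fieldX` and `fieldY`. -/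
theorem direction_eq {x u v u₁ v₁ ux vx s : ℝ} (hv : v ≠ 0) (hs : s ≠ 0) :
    ((ux, vx, rhsU d s (x, (u, v, u₁, v₁), (ux, vx)),
      rhsV c d s (x, (u, v, u₁, v₁), (ux, vx))) : Values) =
    ux • fieldX c d (u, v, u₁, v₁) s + (vx / (v * s)) • fieldY (u, v, u₁, v₁) s := by
  simp only [rhsU, rhsV, fieldX, fieldY]
  refine Prod.ext ?_ (Prod.ext ?_ (Prod.ext ?_ ?_))
  · simp
  · simp
    field_simp
  · simp
    ring
  · simp
    ring

/-- `J₂` is an integral of a system of the required form as soon as `D` satisfies the determining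
equations. -/
theorem J₂_eq (hc : c ≠ 0) {U : Set Args} {f g : Args → ℝ} {D : Values → ℝ} {a b x : ℝ}
    {u v u₁ v₁ : ℝ → ℝ} {n n' : ℕ} (hnd : U ⊆ nondegenerate d)
    (h : IsSolutionOn U f g a b u v u₁ v₁) (hx : x ∈ Set.Ioo a b)
    (hf : ∀ p ∈ U, f p = rhsU d (D p.2.1) p) (hg : ∀ p ∈ U, g p = rhsV c d (D p.2.1) p)
    (hD : DifferentiableAt ℝ D (u x, v x, u₁ x, v₁ x)) (hD0 : D (u x, v x, u₁ x, v₁ x) ≠ 0)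
    (hdet : Determining c d D (u x, v x, u₁ x, v₁ x)) :
    J₂ c d x n (jetAt u₁ v₁ x) = J₂ c d x n' (jetAt u v x) := by
  obtain ⟨n1, n2, n3, n4, n5⟩ := hnd (h.mem x hx)
  have du := hasDerivAt_of_contDiffOn_two h.smooth_u hx
  have dv := hasDerivAt_of_contDiffOn_two h.smooth_v hx
  have du₁ := hasDerivAt_of_contDiffOn_two h.smooth_u₁ hx
  have dv₁ := hasDerivAt_of_contDiffOn_two h.smooth_v₁ hx
  have dux := hasDerivAt_deriv_of_contDiffOn_two h.smooth_u hx
  have e1 := (h.eq_u x hx).trans (hf _ (h.mem x hx))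
  have e2 := (h.eq_v x hx).trans (hg _ (h.mem x hx))
  have dσ : HasDerivAt (fun t => D (u t, v t, u₁ t, v₁ t))
      (fderiv ℝ D (u x, v x, u₁ x, v₁ x) (deriv u x, deriv v x, deriv u₁ x, deriv v₁ x)) x :=
    HasFDerivAt.comp_hasDerivAt x (f := fun t => (u t, v t, u₁ t, v₁ t)) hD.hasFDerivAt
      (du.prodMk (dv.prodMk (du₁.prodMk dv₁)))
  have hev : deriv u₁ =ᶠ[𝓝 x] fun t => v t * (u₁ t * v₁ t + d) * D (u t, v t, u₁ t, v₁ t) /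
      (v₁ t * (u t * v t + d)) * deriv u t := by
    filter_upwards [isOpen_Ioo.mem_nhds hx] with t ht
    exact (h.eq_u t ht).trans (hf _ (h.mem t ht))
  have e3 := hev.deriv_eq
  have hσ : fderiv ℝ D (u x, v x, u₁ x, v₁ x) (deriv u x, deriv v x, deriv u₁ x, deriv v₁ x) =
      deriv u x * slopeX c d (u x, v x, u₁ x, v₁ x) (D (u x, v x, u₁ x, v₁ x)) +
      deriv v x / (v x * D (u x, v x, u₁ x, v₁ x)) * slopeY (D (u x, v x, u₁ x, v₁ x)) := by
    rw [e1, e2]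
    simp only [argsAt]
    rw [direction_eq n2 hD0, map_add, map_smul, map_smul, hdet.1, hdet.2, smul_eq_mul,
      smul_eq_mul]
  rw [hσ] at dσ
  have e4 := (((((dv.fun_mul ((du₁.fun_mul dv₁).add_const d)).fun_mul dσ).fun_div
    (dv₁.fun_mul ((du.fun_mul dv).add_const d)) (mul_ne_zero n3 n4)).fun_mul dux)).deriv
  rw [e4, e1, e2] at e3
  simp only [J₂, jetAt]
  rw [e3, e1, e2]
  simp only [argsAt, rhsU, rhsV, slopeX, slopeY]
  generalize D (u x, v x, u₁ x, v₁ x) = s at *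
  generalize deriv (deriv u) x = uxx at *
  generalize deriv u x = ux at *
  generalize deriv v x = vx at *
  generalize u x = a at *
  generalize v x = b at *
  generalize u₁ x = a₁ at *
  generalize v₁ x = b₁ at *
  have h3' : b * a + d ≠ 0 := by rwa [mul_comm]
  have h4' : b₁ * a₁ + d ≠ 0 := by rwa [mul_comm]
  field_simp
  ring

theorem admitsNIntegral_of_hasForm (hc : c ≠ 0) (hd : d ≠ 0) (hcd : c + d ≠ 0)
    {U : ℕ → Set Args} (hU : ∀ n, IsOpen (U n)) (hnd : ∀ n, U n ⊆ nondegenerate d)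
    {f g : ℕ → Args → ℝ} (h : HasForm c d U f g) :
    AdmitsNIntegral U f g (integralDomain d) (I₂ c d) ∧
      AdmitsNIntegral U f g (integralDomain d) (J₂ c d) := by
  obtain ⟨D, hD⟩ := h
  have hdom : ∀ (n : ℕ) (a b : ℝ) (u v u₁ v₁ : ℝ → ℝ),
      IsSolutionOn (U n) (f n) (g n) a b u v u₁ v₁ → ∀ x ∈ Set.Ioo a b,
      jetAt u v x ∈ integralDomain d ∧ jetAt u₁ v₁ x ∈ integralDomain d := by
    intro n a b u v u₁ v₁ hsol x hx
    obtain ⟨-, h0, hfg, -⟩ := hD n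
    obtain ⟨n1, n2, n3, n4, n5⟩ := hnd n (hsol.mem x hx)
    refine ⟨⟨n1, n4⟩, ⟨?_, n5⟩⟩
    rw [hsol.eq_u x hx, (hfg _ (hsol.mem x hx)).1]
    exact mul_ne_zero (div_ne_zero (mul_ne_zero (mul_ne_zero n2 n5)
      (h0 _ (Set.mem_image_of_mem _ (hsol.mem x hx)))) (mul_ne_zero n3 n4)) n1
  constructor
  · intro n a b u v u₁ v₁ hsol x hx
    obtain ⟨-, h0, hfg, -⟩ := hD n
    have hm := hsol.mem x hx
    obtain ⟨n1, n2, n3, n4, n5⟩ := hnd n hm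
    refine ⟨(hdom n a b u v u₁ v₁ hsol x hx).1, (hdom n a b u v u₁ v₁ hsol x hx).2, ?_⟩
    simp only [jetAt]
    rw [hsol.eq_u x hx, hsol.eq_v x hx, (hfg _ hm).1, (hfg _ hm).2]
    exact I₂_eq hc n2 n3 n4 n5 (h0 _ (Set.mem_image_of_mem _ hm)) rfl
  · intro n a b u v u₁ v₁ hsol x hx
    obtain ⟨hsm, h0, hfg, himp⟩ := hD n
    have hm := hsol.mem x hx
    refine ⟨(hdom n a b u v u₁ v₁ hsol x hx).1, (hdom n a b u v u₁ v₁ hsol x hx).2, ?_⟩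
    have hΩ : IsOpen (valuesOf (U n)) :=
      (isOpenMap_fst.comp isOpenMap_snd) _ (hU n)
    have hΩnd : valuesOf (U n) ⊆ nondegenerateValues d := by
      rintro _ ⟨p, hp, rfl⟩
      exact (hnd n hp).2
    have hq : (u x, v x, u₁ x, v₁ x) ∈ valuesOf (U n) := Set.mem_image_of_mem _ hm
    exact J₂_eq hc (hnd n) hsol hx (fun p hp => (hfg p hp).1) (fun p hp => (hfg p hp).2)
      ((hsm.contDiffAt (hΩ.mem_nhds hq)).differentiableAt (by simp)) (h0 _ hq)
      (determining_of_regular hc hd hcd hΩ hΩnd hsm h0 himp hq)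

end sufficiency

/-! ### Conditions imposed by the integrals at a point -/

section necessity

variable {c d : ℝ} {f g : Args → ℝ}

/-- The value of `𝒟₂` as determined by `f`: the first equation of the system solved for `𝒟₂`. -/
def slopeRatio (d : ℝ) (f : Args → ℝ) : Args → ℝ :=
  fun p => f p * (p.2.1.2.2.2 * (p.2.1.1 * p.2.1.2.1 + d) /
    (p.2.1.2.1 * (p.2.1.2.2.1 * p.2.1.2.2.2 + d) * p.2.2.1))

theorem contDiffAt_slopeRatio {p : Args} (hp : p ∈ nondegenerate d) (hf : ContDiffAt ℝ ∞ f p) :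
    ContDiffAt ℝ ∞ (slopeRatio d f) p := by
  obtain ⟨n1, n2, n3, n4, n5⟩ := hp
  have h : p.2.1.2.1 * (p.2.1.2.2.1 * p.2.1.2.2.2 + d) * p.2.2.1 ≠ 0 :=
    mul_ne_zero (mul_ne_zero n2 n5) n1
  unfold slopeRatio
  fun_prop (disch := assumption)

theorem eq_rhsU_slopeRatio {p : Args} (hp : p ∈ nondegenerate d) :
    f p = rhsU d (slopeRatio d f p) p := by
  obtain ⟨x, ⟨u, v, u₁, v₁⟩, ux, vx⟩ := p
  obtain ⟨n1, n2, n3, n4, n5⟩ := hp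
  simp only [rhsU, slopeRatio]
  have h4' : v * u + d ≠ 0 := by rwa [mul_comm]
  field_simp

theorem fderiv_slopeRatio {x u v u₁ v₁ ux vx : ℝ}
    (hp : (x, (u, v, u₁, v₁), (ux, vx)) ∈ nondegenerate d)
    (hf : DifferentiableAt ℝ f (x, (u, v, u₁, v₁), (ux, vx))) (e a b a₁ b₁ e₁ e₂ : ℝ) :
    fderiv ℝ (slopeRatio d f) (x, (u, v, u₁, v₁), (ux, vx)) (e, (a, b, a₁, b₁), (e₁, e₂)) =
      v₁ * (u * v + d) / (v * (u₁ * v₁ + d) * ux) *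
        (fderiv ℝ f (x, (u, v, u₁, v₁), (ux, vx)) (e, (a, b, a₁, b₁), (e₁, e₂)) +
        f (x, (u, v, u₁, v₁), (ux, vx)) * (b₁ / v₁ + (a * v + u * b) / (u * v + d) - b / v -
          (a₁ * v₁ + u₁ * b₁) / (u₁ * v₁ + d) - e₁ / ux)) := by
  obtain ⟨n1, n2, n3, n4, n5⟩ := hp
  set p : Args := (x, (u, v, u₁, v₁), (ux, vx)) with hp
  set w : Args := (e, (a, b, a₁, b₁), (e₁, e₂)) with hw
  have hfl := hasDerivAt_comp_line hf w
  have n6 : (v + 0 * b) * ((u₁ + 0 * a₁) * (v₁ + 0 * b₁) + d) * (ux + 0 * e₁) ≠ 0 := by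
    simpa using ⟨⟨n2, n5⟩, n1⟩
  have h1 := hfl.fun_mul (((hasDerivAt_line v₁ b₁).fun_mul
    (((hasDerivAt_line u a).fun_mul (hasDerivAt_line v b)).add_const d)).fun_div
    (((hasDerivAt_line v b).fun_mul (((hasDerivAt_line u₁ a₁).fun_mul
      (hasDerivAt_line v₁ b₁)).add_const d)).fun_mul (hasDerivAt_line ux e₁)) n6)
  have hS : DifferentiableAt ℝ (slopeRatio d f) p := by
    have h : p.2.1.2.1 * (p.2.1.2.2.1 * p.2.1.2.2.2 + d) * p.2.2.1 ≠ 0 :=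
      mul_ne_zero (mul_ne_zero n2 n5) n1
    unfold slopeRatio
    fun_prop (disch := assumption)
  rw [(hasDerivAt_comp_line hS w).unique h1, zero_smul, add_zero]
  simp only [zero_mul, add_zero]
  have h4' : v * u + d ≠ 0 := by rwa [mul_comm]
  have h5' : v₁ * u₁ + d ≠ 0 := by rwa [mul_comm]
  field_simp
  ring

/-- What the two integrals imply at a single point `p`, with `𝒟₂` read off from `f` as a function
`slopeRatio d f` of all arguments: `g` has the required form, and the derivatives of
`slopeRatio d f` along `u_x`, along `v_x` and along the flow with frozen `u_x, v_x` are as prescribed. -/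
structure IntegralConditions (c d : ℝ) (f g : Args → ℝ) (p : Args) : Prop where
  ne_zero : slopeRatio d f p ≠ 0
  eq_g : g p = rhsV c d (slopeRatio d f p) p
  fderiv_ux : fderiv ℝ (slopeRatio d f) p (0, 0, (1, 0)) = 0
  fderiv_vx : fderiv ℝ (slopeRatio d f) p (0, 0, (0, 1)) = 0
  fderiv_flow : fderiv ℝ (slopeRatio d f) p
      (1, p.2.2.1 • fieldX c d p.2.1 (slopeRatio d f p) +
        (p.2.2.2 / (p.2.1.2.1 * slopeRatio d f p)) • fieldY p.2.1 (slopeRatio d f p), 0) =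
    p.2.2.1 * slopeX c d p.2.1 (slopeRatio d f p) +
      p.2.2.2 / (p.2.1.2.1 * slopeRatio d f p) * slopeY (slopeRatio d f p)

/-- The invariance of `I₂` is solved for `g`. The invariance of `J₂` is an identity in `u_xx, v_xx`,
which are arbitrary at a given point; both sides are affine in them, and comparing coefficients
gives the three derivatives. -/
theorem integralConditions_of_admits (hc : c ≠ 0) {U : ℕ → Set Args} {f g : ℕ → Args → ℝ} {n : ℕ}
    (hU : IsOpen (U n)) (hnd : U n ⊆ nondegenerate d)
    (hf : ContDiffOn ℝ ∞ (f n) (U n)) (hg : ContDiffOn ℝ ∞ (g n) (U n))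
    (hI : AdmitsNIntegral U f g (integralDomain d) (I₂ c d))
    (hJ : AdmitsNIntegral U f g (integralDomain d) (J₂ c d))
    {p : Args} (hp : p ∈ U n) : IntegralConditions c d (f n) (g n) p := by
  have hndp := hnd hp
  have hfd : DifferentiableAt ℝ (f n) p :=
    (hf.contDiffAt (hU.mem_nhds hp)).differentiableAt (by simp)
  obtain ⟨x, ⟨u, v, u₁, v₁⟩, ux, vx⟩ := p
  have key : ∀ uxx vxx : ℝ, f n (x, (u, v, u₁, v₁), (ux, vx)) ≠ 0 ∧
      (d - c) * v₁ ^ 2 * f n (x, (u, v, u₁, v₁), (ux, vx)) ^ 2 / (2 * (u₁ * v₁ + d) ^ 2) -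
        c * f n (x, (u, v, u₁, v₁), (ux, vx)) * g n (x, (u, v, u₁, v₁), (ux, vx)) /
          (u₁ * v₁ + d) =
      (d - c) * v ^ 2 * ux ^ 2 / (2 * (u * v + d) ^ 2) - c * ux * vx / (u * v + d) ∧
      fderiv ℝ (f n) (x, (u, v, u₁, v₁), (ux, vx)) (1, (ux, vx,
        f n (x, (u, v, u₁, v₁), (ux, vx)), g n (x, (u, v, u₁, v₁), (ux, vx))), (uxx, vxx)) /
          f n (x, (u, v, u₁, v₁), (ux, vx)) +
        ((d - c) * v₁ * f n (x, (u, v, u₁, v₁), (ux, vx)) -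
          c * u₁ * g n (x, (u, v, u₁, v₁), (ux, vx))) / (c * (u₁ * v₁ + d)) =
      uxx / ux + ((d - c) * v * ux - c * u * vx) / (c * (u * v + d)) := by
    intro uxx vxx
    obtain ⟨a, b, U, V, U₁, V₁, hsol, hx, hargs, huxx, hvxx⟩ :=
      exists_isSolutionOn hU hf hg hp uxx vxx
    obtain ⟨-, h1, h2⟩ := hI n a b U V U₁ V₁ hsol x hx
    obtain ⟨-, -, h3⟩ := hJ n a b U V U₁ V₁ hsol x hx
    have h4 : deriv U₁ x ≠ 0 := h1.1
    simp only at hargs huxx hvxx hx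
    simp only [I₂, J₂, jetAt] at h2 h3
    rw [hsol.deriv_deriv hU hf hx, hsol.eq_u _ hx, hsol.eq_v _ hx, hargs, huxx, hvxx] at h3
    rw [hsol.eq_u _ hx, hsol.eq_v _ hx, hargs] at h2
    rw [hsol.eq_u _ hx, hargs] at h4
    simp only [argsAt, Prod.mk.injEq] at hargs
    obtain ⟨-, ⟨e1, e2, e3, e4⟩, e5, e6⟩ := hargs
    rw [e1, e2, e3, e4, e5, e6] at h2 h3
    exact ⟨h4, h2, h3⟩
  generalize f n = f at *
  generalize g n = g at *
  obtain ⟨hf0, hIeq, hJ00⟩ := key 0 0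
  obtain ⟨-, -, hJ10⟩ := key 1 0
  obtain ⟨-, -, hJ01⟩ := key 0 1
  have hS := eq_rhsU_slopeRatio (f := f) hndp
  have hder := fderiv_slopeRatio hndp hfd
  obtain ⟨n1, n2, n3, n4, n5⟩ := hndp
  set l := fderiv ℝ f (x, (u, v, u₁, v₁), (ux, vx)) with hl
  set s := slopeRatio d f (x, (u, v, u₁, v₁), (ux, vx)) with hs
  have hs0 : s ≠ 0 := by
    intro h0
    rw [h0] at hS
    simp only [rhsU] at hS
    exact hf0 (by rw [hS]; simp)
  have h4' : v * u + d ≠ 0 := by rwa [mul_comm]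
  have h5' : v₁ * u₁ + d ≠ 0 := by rwa [mul_comm]
  have hgeq : g (x, (u, v, u₁, v₁), (ux, vx)) =
      rhsV c d s (x, (u, v, u₁, v₁), (ux, vx)) := by
    have h1 := I₂_eq (c := c) (x := x) (x' := x) (n := 0) (n' := 0) (y := 0) (y' := 0) (ux := ux)
      (vx := vx) hc n2 n3 n4 n5 hs0 rfl
    simp only [I₂] at h1
    rw [← hS] at h1
    have h2 := hIeq.trans h1.symm
    refine mul_left_cancel₀ (mul_ne_zero hc hf0) ?_
    have h3 := (sub_right_inj.1 h2)
    field_simp at h3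
    linear_combination c * f (x, (u, v, u₁, v₁), (ux, vx)) * h3
  have hl10 : l (0, 0, (1, 0)) = f (x, (u, v, u₁, v₁), (ux, vx)) / ux := by
    have h1 : ((0, 0, (1, 0)) : Args) = (1, (ux, vx, f (x, (u, v, u₁, v₁), (ux, vx)),
        g (x, (u, v, u₁, v₁), (ux, vx))), (1, 0)) - (1, (ux, vx, f (x, (u, v, u₁, v₁), (ux, vx)),
        g (x, (u, v, u₁, v₁), (ux, vx))), (0, 0)) := by simp
    rw [h1, map_sub]
    have h2 : ∀ A B X R : ℝ, A / f (x, (u, v, u₁, v₁), (ux, vx)) + X = 1 / ux + R →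
        B / f (x, (u, v, u₁, v₁), (ux, vx)) + X = 0 / ux + R →
        A - B = f (x, (u, v, u₁, v₁), (ux, vx)) / ux := by
      intro A B X R hA hB
      have : A / f (x, (u, v, u₁, v₁), (ux, vx)) - B / f (x, (u, v, u₁, v₁), (ux, vx)) =
          1 / ux := by
        rw [zero_div] at hB
        linarith
      field_simp at this ⊢
      linarith
    exact h2 _ _ _ _ hJ10 hJ00
  have hl01 : l (0, 0, (0, 1)) = 0 := by
    have h1 : ((0, 0, (0, 1)) : Args) = (1, (ux, vx, f (x, (u, v, u₁, v₁), (ux, vx)),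
        g (x, (u, v, u₁, v₁), (ux, vx))), (0, 1)) - (1, (ux, vx, f (x, (u, v, u₁, v₁), (ux, vx)),
        g (x, (u, v, u₁, v₁), (ux, vx))), (0, 0)) := by simp
    rw [h1, map_sub]
    exact sub_eq_zero.2 ((div_left_inj' hf0).1 (add_right_cancel (hJ01.trans hJ00.symm)))
  refine ⟨hs0, hgeq, ?_, ?_, ?_⟩
  · refine (hder 0 0 0 0 0 1 0).trans ?_
    rw [show ((0, (0, 0, 0, 0), (1, 0)) : Args) = (0, 0, (1, 0)) from rfl, hl10]
    field_simp
    ring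
  · refine (hder 0 0 0 0 0 0 1).trans ?_
    rw [show ((0, (0, 0, 0, 0), (0, 1)) : Args) = (0, 0, (0, 1)) from rfl, hl01]
    simp
  · simp only
    rw [← direction_eq n2 hs0, ← hS, ← hgeq]
    refine (hder 1 _ _ _ _ 0 0).trans ?_
    have h1 : l (1, (ux, vx, f (x, (u, v, u₁, v₁), (ux, vx)),
        g (x, (u, v, u₁, v₁), (ux, vx))), (0, 0)) = f (x, (u, v, u₁, v₁), (ux, vx)) *
        (((d - c) * v * ux - c * u * vx) / (c * (u * v + d)) -
          ((d - c) * v₁ * f (x, (u, v, u₁, v₁), (ux, vx)) -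
            c * u₁ * g (x, (u, v, u₁, v₁), (ux, vx))) / (c * (u₁ * v₁ + d))) := by
      rw [zero_div, zero_add] at hJ00
      rw [mul_comm, ← div_eq_iff hf0]
      linear_combination hJ00
    rw [h1, hgeq, hS]
    rw [← hs]
    clear_value s
    simp only [rhsU, rhsV, slopeX, slopeY]
    field_simp
    ring

end necessity

/-! ### Descent to a function of `(u, v, u₁, v₁)` -/

section fibres

variable {c d : ℝ} {U : Set Args} {f g : Args → ℝ}

/-- A function whose derivatives along `u_x` and `v_x` vanish is locally independent of them. -/
theorem eventually_eq_freeze {S : Args → ℝ} (hU : IsOpen U)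
    (hS : ∀ p ∈ U, DifferentiableAt ℝ S p)
    (h1 : ∀ p ∈ U, fderiv ℝ S p (0, 0, (1, 0)) = 0) (h2 : ∀ p ∈ U, fderiv ℝ S p (0, 0, (0, 1)) = 0)
    {p : Args} (hp : p ∈ U) : ∀ᶠ r in 𝓝 p, S r = S (r.1, r.2.1, p.2.2) := by
  obtain ⟨R, hR, hball⟩ := Metric.mem_nhds_iff.1 (hU.mem_nhds hp)
  filter_upwards [Metric.ball_mem_nhds p hR] with r hr
  have hr' : ((r.1, r.2.1, p.2.2) : Args) ∈ Metric.ball p R := by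
    rw [Metric.mem_ball] at hr ⊢
    refine lt_of_le_of_lt ?_ hr
    rw [Prod.dist_eq, Prod.dist_eq, Prod.dist_eq, Prod.dist_eq, dist_self]
    exact max_le_max le_rfl (max_le_max le_rfl dist_nonneg)
  refine eq_of_fderiv_apply_sub_eq_zero (convex_ball p R) (fun z hz => hS z (hball hz)) hr' hr
    fun z hz => ?_
  have : r - (r.1, r.2.1, p.2.2) = (r.2.2.1 - p.2.2.1) • ((0, 0, (1, 0)) : Args) +
      (r.2.2.2 - p.2.2.2) • ((0, 0, (0, 1)) : Args) := by
    ext <;> simp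
  rw [this, map_add, map_smul, map_smul, h1 z (hball hz), h2 z (hball hz)]
  simp

theorem affine_coefficients_eq_zero {α β γ x y : ℝ}
    (h : ∀ᶠ w : ℝ × ℝ in 𝓝 (x, y), α + w.1 * β + w.2 * γ = 0) : α = 0 ∧ β = 0 ∧ γ = 0 := by
  obtain ⟨R, hR, hball⟩ := Metric.eventually_nhds_iff_ball.1 h
  have h0 := hball (x, y) (by simpa using hR)
  have h1 := hball (x + R / 2, y) (by
    simp [Prod.dist_eq, abs_of_pos hR]; linarith)
  have h2 := hball (x, y + R / 2) (by
    simp [Prod.dist_eq, abs_of_pos hR]; linarith)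
  simp only at h0 h1 h2
  have hR2 : R / 2 ≠ 0 := by positivity
  have hβ : β = 0 := mul_left_cancel₀ hR2 (by linear_combination h1 - h0)
  have hγ : γ = 0 := mul_left_cancel₀ hR2 (by linear_combination h2 - h0)
  subst hβ hγ
  exact ⟨by simpa using h0, rfl, rfl⟩

/-- The flow condition is affine in `(u_x, v_x)`, with coefficients which do not depend on them
locally, so each coefficient vanishes. These are the independence of `x` and the two determining
equations. -/
theorem fderiv_slopeRatio_split (hU : IsOpen U) (hnd : U ⊆ nondegenerate d)
    (hf : ContDiffOn ℝ ∞ f U) (hpt : ∀ p ∈ U, IntegralConditions c d f g p)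
    {p : Args} (hp : p ∈ U) :
    fderiv ℝ (slopeRatio d f) p (1, 0, 0) = 0 ∧
    fderiv ℝ (slopeRatio d f) p (0, fieldX c d p.2.1 (slopeRatio d f p), 0) =
      slopeX c d p.2.1 (slopeRatio d f p) ∧
    fderiv ℝ (slopeRatio d f) p (0, fieldY p.2.1 (slopeRatio d f p), 0) =
      slopeY (slopeRatio d f p) := by
  set S := slopeRatio d f with hSdef
  have hS : ∀ p ∈ U, DifferentiableAt ℝ S p := fun p hp =>
    (contDiffAt_slopeRatio (hnd hp) (hf.contDiffAt (hU.mem_nhds hp))).differentiableAt (by simp)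
  have hfreeze := eventually_eq_freeze hU hS (fun p hp => (hpt p hp).fderiv_ux)
    (fun p hp => (hpt p hp).fderiv_vx) hp
  let ι : ℝ × ℝ → Args := fun w => (p.1, p.2.1, w)
  have hι : Tendsto ι (𝓝 p.2.2) (𝓝 p) :=
    (show Continuous ι by fun_prop).tendsto p.2.2
  have hev : ∀ᶠ w in 𝓝 p.2.2, ι w ∈ U ∧ S (ι w) = S p ∧
      ∀ (e : ℝ) (a : Values), fderiv ℝ S (ι w) (e, a, 0) = fderiv ℝ S p (e, a, 0) := by
    filter_upwards [hι (hU.mem_nhds hp), hι.eventually hfreeze.eventually_nhds] with w hw1 hw2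
    refine ⟨hw1, hw2.self_of_nhds, fun e a => ?_⟩
    have h1 : S =ᶠ[𝓝 (ι w)] fun r => S (r.1, r.2.1, p.2.2) := hw2
    rw [h1.fderiv_eq]
    have h2 : HasFDerivAt (fun r : Args => ((r.1, r.2.1, p.2.2) : Args))
        ((ContinuousLinearMap.fst ℝ ℝ (Values × ℝ × ℝ)).prod
          (((ContinuousLinearMap.fst ℝ Values (ℝ × ℝ)).comp
            (ContinuousLinearMap.snd ℝ ℝ (Values × ℝ × ℝ))).prod 0)) (ι w) :=
      hasFDerivAt_fst.prodMk ((hasFDerivAt_fst.comp _ hasFDerivAt_snd).prodMk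
        (hasFDerivAt_const _ _))
    have h3 := HasFDerivAt.comp (ι w) (f := fun r : Args => ((r.1, r.2.1, p.2.2) : Args))
      (hS p hp).hasFDerivAt h2
    have h4 := h3.fderiv
    exact DFunLike.congr_fun h4 (e, a, 0)
  have hs0 := (hpt p hp).ne_zero
  have hv0 : p.2.1.2.1 ≠ 0 := (hnd hp).2.1
  have hvs : p.2.1.2.1 * S p ≠ 0 := mul_ne_zero hv0 hs0
  have haff : ∀ᶠ w : ℝ × ℝ in 𝓝 (p.2.2.1, p.2.2.2), fderiv ℝ S p (1, 0, 0) +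
      w.1 * (fderiv ℝ S p (0, fieldX c d p.2.1 (S p), 0) - slopeX c d p.2.1 (S p)) +
      w.2 * ((fderiv ℝ S p (0, fieldY p.2.1 (S p), 0) - slopeY (S p)) / (p.2.1.2.1 * S p)) = 0 := by
    filter_upwards [hev] with w ⟨h1, h2, h3⟩
    have h4 := (hpt _ h1).fderiv_flow
    rw [← hSdef, h2, h3] at h4
    simp only [ι] at h4
    have h5 : ((1, w.1 • fieldX c d p.2.1 (S p) +
        (w.2 / (p.2.1.2.1 * S p)) • fieldY p.2.1 (S p), 0) : Args) = (1, 0, 0) +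
        w.1 • (0, fieldX c d p.2.1 (S p), 0) +
        (w.2 / (p.2.1.2.1 * S p)) • (0, fieldY p.2.1 (S p), 0) := by
      simp
    rw [h5, map_add, map_add, map_smul, map_smul, smul_eq_mul, smul_eq_mul] at h4
    linear_combination h4
  obtain ⟨h1, h2, h3⟩ := affine_coefficients_eq_zero haff
  exact ⟨h1, sub_eq_zero.1 h2, sub_eq_zero.1 ((div_eq_zero_iff.1 h3).resolve_right hvs)⟩

/-- The connectedness of the fibres turns local independence of `(x, u_x, v_x)` into global
independence. -/
theorem eq_of_fderiv_fibre_eq_zero {S : Args → ℝ} (hU : IsOpen U)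
    (hS : ∀ p ∈ U, DifferentiableAt ℝ S p) (h0 : ∀ p ∈ U, fderiv ℝ S p (1, 0, 0) = 0)
    (h1 : ∀ p ∈ U, fderiv ℝ S p (0, 0, (1, 0)) = 0) (h2 : ∀ p ∈ U, fderiv ℝ S p (0, 0, (0, 1)) = 0)
    (hfib : ∀ q : Values, IsPreconnected {s : ℝ × ℝ × ℝ | (s.1, q, s.2) ∈ U})
    {p r : Args} (hp : p ∈ U) (hr : r ∈ U) (hpr : p.2.1 = r.2.1) : S p = S r := by
  let ι : ℝ × ℝ × ℝ → Args := fun s => (s.1, p.2.1, s.2)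
  have hι : ∀ s, HasFDerivAt ι ((ContinuousLinearMap.fst ℝ ℝ (ℝ × ℝ)).prod
      ((0 : ℝ × ℝ × ℝ →L[ℝ] Values).prod (ContinuousLinearMap.snd ℝ ℝ (ℝ × ℝ)))) s := fun s =>
    hasFDerivAt_fst.prodMk ((hasFDerivAt_const p.2.1 s).prodMk hasFDerivAt_snd)
  have hopen : IsOpen {s : ℝ × ℝ × ℝ | (s.1, p.2.1, s.2) ∈ U} :=
    hU.preimage (show Continuous ι by fun_prop)
  have hd : ∀ s ∈ {s : ℝ × ℝ × ℝ | (s.1, p.2.1, s.2) ∈ U},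
      HasFDerivAt (S ∘ ι) (0 : ℝ × ℝ × ℝ →L[ℝ] ℝ) s := by
    intro s hs
    refine ((hS _ hs).hasFDerivAt.comp s (hι s)).congr_fderiv ?_
    ext
    · exact h0 _ hs
    · exact h1 _ hs
    · exact h2 _ hs
  have := hopen.is_const_of_fderiv_eq_zero (𝕜 := ℝ) (hfib p.2.1)
    (fun s hs => (hd s hs).differentiableAt.differentiableWithinAt) (fun s hs => (hd s hs).fderiv)
    (x := (p.1, p.2.2)) (y := (r.1, r.2.2)) hp (by rw [hpr]; exact hr)
  simp only [Function.comp_apply, ι] at this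
  rw [hpr] at this
  rw [show p = (p.1, r.2.1, p.2.2) by rw [← hpr]]
  exact this

/-- The function `𝒟₂` is `slopeRatio d f`, which descends to a function of the values
`(u, v, u₁, v₁)`. -/
theorem exists_form (hc : c ≠ 0) (hd : d ≠ 0) (hcd : c + d ≠ 0) (hU : IsOpen U)
    (hnd : U ⊆ nondegenerate d) (hf : ContDiffOn ℝ ∞ f U)
    (hfib : ∀ q : Values, IsPreconnected {s : ℝ × ℝ × ℝ | (s.1, q, s.2) ∈ U})
    (hpt : ∀ p ∈ U, IntegralConditions c d f g p) :
    ∃ D : Values → ℝ, ContDiffOn ℝ ∞ D (valuesOf U) ∧ (∀ q ∈ valuesOf U, D q ≠ 0) ∧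
      (∀ p ∈ U, f p = rhsU d (D p.2.1) p ∧ g p = rhsV c d (D p.2.1) p) ∧
      (∀ q ∈ valuesOf U, Regular c d q (D q) → GivenImplicitlyAt c d D q) := by
  have hSs : ∀ p ∈ U, ContDiffAt ℝ ∞ (slopeRatio d f) p := fun p hp =>
    contDiffAt_slopeRatio (hnd hp) (hf.contDiffAt (hU.mem_nhds hp))
  have hconst : ∀ p ∈ U, ∀ r ∈ U, p.2.1 = r.2.1 → slopeRatio d f p = slopeRatio d f r :=
    fun p hp r hr => eq_of_fderiv_fibre_eq_zero hU
      (fun p hp => (hSs p hp).differentiableAt (by simp))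
      (fun p hp => (fderiv_slopeRatio_split hU hnd hf hpt hp).1)
      (fun p hp => (hpt p hp).fderiv_ux) (fun p hp => (hpt p hp).fderiv_vx) hfib hp hr
  classical
  let D : Values → ℝ := fun q =>
    if h : ∃ p ∈ U, p.2.1 = q then slopeRatio d f h.choose else 0
  have hD : ∀ p ∈ U, D p.2.1 = slopeRatio d f p := by
    intro p hp
    have h : ∃ r ∈ U, r.2.1 = p.2.1 := ⟨p, hp, rfl⟩
    simp only [D, dif_pos h]
    exact hconst _ h.choose_spec.1 _ hp h.choose_spec.2
  have hloc : ∀ p ∈ U, D =ᶠ[𝓝 p.2.1] fun q => slopeRatio d f (p.1, q, p.2.2) := by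
    intro p hp
    have hcont : Tendsto (fun q : Values => ((p.1, q, p.2.2) : Args)) (𝓝 p.2.1) (𝓝 p) :=
      (show Continuous (fun q : Values => ((p.1, q, p.2.2) : Args)) by fun_prop).tendsto _
    filter_upwards [hcont (hU.mem_nhds hp)] with q hq
    exact hD _ hq
  have hDs : ∀ q ∈ valuesOf U, ContDiffAt ℝ ∞ D q := by
    rintro _ ⟨p, hp, rfl⟩
    refine ContDiffAt.congr_of_eventuallyEq ?_ (hloc p hp)
    exact (hSs p hp).comp (f := fun q : Values => ((p.1, q, p.2.2) : Args)) p.2.1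
      (contDiffAt_const.prodMk (contDiffAt_id.prodMk contDiffAt_const))
  have hΩ : IsOpen (valuesOf U) := (isOpenMap_fst.comp isOpenMap_snd) _ hU
  have hΩnd : valuesOf U ⊆ nondegenerateValues d := by
    rintro _ ⟨p, hp, rfl⟩
    exact (hnd hp).2
  have hD0 : ∀ q ∈ valuesOf U, D q ≠ 0 := by
    rintro _ ⟨p, hp, rfl⟩
    rw [hD p hp]
    exact (hpt p hp).ne_zero
  have hdet : ∀ q ∈ valuesOf U, Determining c d D q := by
    rintro _ ⟨p, hp, rfl⟩
    have hder : ∀ a : Values, fderiv ℝ D p.2.1 a = fderiv ℝ (slopeRatio d f) p (0, a, 0) := by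
      intro a
      rw [(hloc p hp).fderiv_eq]
      have h1 : HasFDerivAt (fun q : Values => ((p.1, q, p.2.2) : Args))
          ((0 : Values →L[ℝ] ℝ).prod ((ContinuousLinearMap.id ℝ Values).prod 0)) p.2.1 :=
        (hasFDerivAt_const _ _).prodMk ((hasFDerivAt_id _).prodMk (hasFDerivAt_const _ _))
      have h2 := HasFDerivAt.comp p.2.1 (f := fun q : Values => ((p.1, q, p.2.2) : Args))
        ((hSs p hp).differentiableAt (by simp)).hasFDerivAt h1
      exact DFunLike.congr_fun h2.fderiv a
    obtain ⟨-, h1, h2⟩ := fderiv_slopeRatio_split hU hnd hf hpt hp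
    rw [Determining, hder, hder, hD p hp]
    exact ⟨h1, h2⟩
  refine ⟨D, fun q hq => (hDs q hq).contDiffWithinAt, hD0, fun p hp => ?_, fun q hq hreg => ?_⟩
  · rw [hD p hp]
    exact ⟨eq_rhsU_slopeRatio (hnd hp), (hpt p hp).eq_g⟩
  · have hΩq := hΩ.mem_nhds hq
    exact givenImplicitlyAt_of_determining hc hd hcd (mem_of_superset hΩq hDs) (hΩnd hq)
      (hD0 q hq) (mem_of_superset hΩq hdet) hreg

end fibres

end SemiDiscrete

end

theorem theorem2 (c d : ℝ) (hc : c ≠ 0) (hd : d ≠ 0) (hcd : c + d ≠ 0)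
    (U : ℕ → Set SemiDiscrete.Args) (hU : ∀ n, IsOpen (U n))
    (hnd : ∀ n, U n ⊆ SemiDiscrete.nondegenerate d)
    (hfib : ∀ (n : ℕ) (q : SemiDiscrete.Values),
      IsPreconnected {s : ℝ × ℝ × ℝ | (s.1, q, s.2) ∈ U n})
    (f g : ℕ → SemiDiscrete.Args → ℝ)
    (hf : ∀ n, ContDiffOn ℝ ∞ (f n) (U n)) (hg : ∀ n, ContDiffOn ℝ ∞ (g n) (U n)) :
    (SemiDiscrete.AdmitsNIntegral U f g (SemiDiscrete.integralDomain d) (SemiDiscrete.I₂ c d) ∧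
      SemiDiscrete.AdmitsNIntegral U f g (SemiDiscrete.integralDomain d) (SemiDiscrete.J₂ c d)) ↔
    SemiDiscrete.HasForm c d U f g := by
  constructor
  · rintro ⟨hI, hJ⟩
    choose D hD using fun n => SemiDiscrete.exists_form hc hd hcd (hU n) (hnd n) (hf n) (hfib n)
      fun p hp => SemiDiscrete.integralConditions_of_admits hc (hU n) (hnd n) (hf n) (hg n) hI hJ hp
    exact ⟨D, hD⟩
  · exact SemiDiscrete.admitsNIntegral_of_hasForm hc hd hcd hU hnd
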